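/- Let $\mathcal E$ be a finite metric space, let $\lambda,\kappa,\mu\colon\mathcal E\to[0,\infty)$ and fix $t\ge 0$. For a càdlàg process $J=(J(s))_{s\ge0}$ in $\mathcal E$ (the background process), the modulated infinite-server queue $(J,\lambda,\kappa,\mu)$ is defined as follows. Let $\bar\tau_1<\bar\tau_2<\cdots$ be the jump times of a standard Poisson process (partial sums of i.i.d. standard exponential variables) and let $\bar Z_1,\bar Z_2,\dots$ be i.i.d. standard exponential variables, with $J$, $(\bar\tau_k)_k$, $(\bar Z_k)_k$ independent. Job $k$ arrives at time $\tau_k=\inf\{s\ge0:\int_0^s\lambda(J(r))\,dr\ge\bar\tau_k\}$ (with $\inf\emptyset=\infty$), has service requirement $Z_k=\bar Z_k/\kappa(J(\tau_k))$ ($=\infty$ if $\kappa(J(\tau_k))=0$), and is in the system at time $t$ if and only if $\tau_k\le t$ and $Z_k>\int_{\tau_k}^t\mu(J(r))\,dr$. For $n\ge 1$ let $M_n(t)$ be the number of jobs in the system at time $t$ for the queue $(J,n\lambda,\kappa,\mu)$. Put $$\phi_t(J)=\int_0^t\lambda(J(s))\,e^{-\kappa(J(s))\int_s^t\mu(J(r))\,dr}\,ds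 ,$$ let $\nu_n$ be the law of $\phi_t(J)$ for every $n$, let $\mathcal R(t)$ be the set of attainable parameters, i.e. of all $\gamma\ge0$ such that for every $\epsilon>0$, $\nu_n((\gamma-\epsilon,\gamma+\epsilon))>0$ for all sufficiently large $n$, and let $\ell(\gamma;a)=\sup_{\theta\in\mathbb R}[\theta a-\gamma(e^\theta-1)]$ be the Fenchel–Legendre transform of the cumulant generating function of the Poisson distribution with parameter $\gamma$. A sequence of probability measures $(\tau_n)$ on $\mathbb R$ satisfies the large deviations principle (LDP) with rate function $\rho\colon\mathbb R\to[0,\infty]$ if $\rho$ is lower semicontinuous, $\limsup_n\frac1n\log\tau_n(F)\le-\inf_F\rho$ for all closed $F$ and $\liminf_n\frac1n\log\tau_n(G)\ge-\inf_G\rho$ for all open $G$. The rate function is good if $\{\rho\le c\}$ is compact for every $c\in[0,\infty)$. Let $J^{(1)}$ be any càdlàg process with values in $\mathcal E$ and let $J^{(2)}$ be an irreducible continuous-time (time-homogeneous, càdlàg) Markov chain with state space $\mathcal E$ and arbitrary initial distribution. Write $\nu_n^{(i)}$, $\mathcal R^{(i)}(t)$, $M^{(i)}_n(t)$ for the objects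 above with $J=J^{(i)}$. Then for $i=1,2$ the sequence $(\nu_n^{(i)})_n$ satisfies an LDP with some rate function; whenever it does so with rate function $\psi^{(i)}$, the laws of $\frac1nM_n^{(i)}(t)$ satisfy the LDP with rate function $$I^{(i)}(a)=\inf_{\gamma\in\mathcal R^{(i)}(t)}\left[\ell(\gamma;a)+\psi^{(i)}(\gamma)\right].$$ Moreover $I^{(1)}(a)\ge I^{(2)}(a)$ for all $a\in\mathbb R$, and both $I^{(1)}$ and $I^{(2)}$ are good rate functions. -/

import Mathlib

open MeasureTheory ProbabilityTheory Filter Topology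
open scoped NNReal ENNReal

noncomputable section

namespace ModulatedQueue

/-! ### Large deviations -/

/-- A rate function: a lower semicontinuous function with values in `[0, ∞]`. -/
def IsRateFunction {X : Type*} [TopologicalSpace X] (ρ : X → ℝ≥0∞) : Prop :=
  LowerSemicontinuous ρ

/-- A good rate function: a rate function all of whose (finite) level sets are compact. -/
def IsGoodRateFunction {X : Type*} [TopologicalSpace X] (ρ : X → ℝ≥0∞) : Prop :=
  IsRateFunction ρ ∧ ∀ c : ℝ≥0, IsCompact {x | ρ x ≤ c}

/-- The sequence of measures `τ n` satisfies the large deviations principle (with speed `n`) with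
rate function `ρ`. The logarithm is `EReal`-valued, with `log 0 = -∞`. -/
structure SatisfiesLDP {X : Type*} [TopologicalSpace X] [MeasurableSpace X]
    (τ : ℕ → Measure X) (ρ : X → ℝ≥0∞) : Prop where
  isRateFunction : IsRateFunction ρ
  upper : ∀ F : Set X, IsClosed F →
    limsup (fun n : ℕ => ((1 / (n : ℝ) : ℝ) : EReal) * ENNReal.log (τ n F)) atTop
      ≤ -((⨅ a ∈ F, ρ a : ℝ≥0∞) : EReal)
  lower : ∀ G : Set X, IsOpen G →
    -((⨅ a ∈ G, ρ a : ℝ≥0∞) : EReal)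
      ≤ liminf (fun n : ℕ => ((1 / (n : ℝ) : ℝ) : EReal) * ENNReal.log (τ n G)) atTop

/-! ### Background processes -/

/-- Right-continuous with left limits (the condition on left limits is void at time `0`). -/
def IsCadlag {E : Type*} [TopologicalSpace E] (f : ℝ≥0 → E) : Prop :=
  ∀ t, ContinuousWithinAt f (Set.Ici t) t ∧ ∃ x, Tendsto f (𝓝[<] t) (𝓝 x)

/-- A background process: a stochastic process in `E` with càdlàg paths. -/
structure IsBackgroundProcess {Ω E : Type*} [MeasurableSpace Ω] [TopologicalSpace E]
    [MeasurableSpace E] (J : ℝ≥0 → Ω → E) : Prop where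
  measurable : ∀ s, Measurable (J s)
  cadlag : ∀ ω, IsCadlag (fun s => J s ω)

/-- `Q` is the transition rate matrix of a continuous-time Markov chain on a finite set. -/
structure IsRateMatrix {E : Type*} [Fintype E] (Q : Matrix E E ℝ) : Prop where
  nonneg : ∀ x y, x ≠ y → 0 ≤ Q x y
  row_sum : ∀ x, ∑ y, Q x y = 0

/-- Every state can be reached from every state through transitions of positive rate. -/
def IsIrreducibleRateMatrix {E : Type*} (Q : Matrix E E ℝ) : Prop :=
  ∀ x y, Relation.ReflTransGen (fun u v => u ≠ v ∧ 0 < Q u v) x y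

/-- `J` is a continuous-time Markov chain with transition rate matrix `Q`, that is, with
transition matrices `exp (s Q)`, and with arbitrary initial distribution. The Markov property
`P(J(t₀) = x₀, …, J(tₘ₊₁) = xₘ₊₁) = P(J(t₀) = x₀, …, J(tₘ) = xₘ) · exp((tₘ₊₁ - tₘ) Q)(xₘ, xₘ₊₁)` is
stated for all times `t₀ ≤ t₁ ≤ …` and all states. -/
def IsMarkovChainWithRates {Ω E : Type*} [MeasurableSpace Ω] [Fintype E] [DecidableEq E]
    (P : Measure Ω) (J : ℝ≥0 → Ω → E) (Q : Matrix E E ℝ) : Prop :=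
  ∀ (m : ℕ) (s : ℕ → ℝ≥0) (x : ℕ → E), Monotone s →
    P.real {ω | ∀ i ≤ m + 1, J (s i) ω = x i} =
      P.real {ω | ∀ i ≤ m, J (s i) ω = x i} *
        NormedSpace.exp (((s (m + 1) : ℝ) - (s m : ℝ)) • Q) (x m) (x (m + 1))

/-- `J` is an irreducible continuous-time Markov chain on the finite set `E`. -/
def IsIrreducibleMarkovChain {Ω E : Type*} [MeasurableSpace Ω] [Fintype E] [DecidableEq E]
    (P : Measure Ω) (J : ℝ≥0 → Ω → E) : Prop :=
  ∃ Q : Matrix E E ℝ, IsRateMatrix Q ∧ IsIrreducibleRateMatrix Q ∧ IsMarkovChainWithRates P J Q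

/-! ### The modulated infinite-server queue

`lam`, `kap`, `mu` are the functions modulating the arrival rate, the service requirements and the
server work rate; `f` is a path of the background process, `e` the sequence of interarrival times of
the standard Poisson process and `z` the sequence of standard exponential requirements. Jobs are
numbered from `0`. -/

section Queue

variable {E : Type*}

/-- The cumulative arrival rate `Λ(t) = ∫₀ᵗ λ(f(s)) ds`. -/
def cumRate (lam : E → ℝ≥0) (f : ℝ≥0 → E) (t : ℝ≥0) : ℝ :=
  ∫ s in (0 : ℝ)..t, (lam (f s.toNNReal) : ℝ)

/-- The `k`-th jump time of the standard Poisson process with interarrival times `e`. -/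
def poissonJumpTime (e : ℕ → ℝ) (k : ℕ) : ℝ := ∑ i ∈ Finset.range (k + 1), e i

/-- The arrival time `τₖ = inf {t ≥ 0 | Λ(t) ≥ τ̄ₖ}` of job `k`, where `τ̄ₖ` is the `k`-th jump time of
the standard Poisson process; it is `∞` if there is no such `t`. -/
def arrivalTime (lam : E → ℝ≥0) (f : ℝ≥0 → E) (e : ℕ → ℝ) (k : ℕ) : ℝ≥0∞ :=
  ⨅ (t : ℝ≥0) (_ : poissonJumpTime e k ≤ cumRate lam f t), (t : ℝ≥0∞)

/-- The service requirement of a job that arrives while the background process is in state `x`: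
the standard exponential `z` divided by `κ(x)`, and `∞` if `κ(x) = 0`. -/
def serviceRequirement (kap : E → ℝ≥0) (x : E) (z : ℝ) : ℝ≥0∞ :=
  open Classical in if kap x = 0 then ⊤ else ENNReal.ofReal (z / kap x)

/-- The work done up to time `t` by a server that starts at time `u`. -/
def workDone (mu : E → ℝ≥0) (f : ℝ≥0 → E) (u t : ℝ≥0) : ℝ≥0∞ :=
  ENNReal.ofReal (∫ r in (u : ℝ)..t, (mu (f r.toNNReal) : ℝ))

/-- Job `k` is in the system at time `t`: it has arrived, and its service requirement has not been
processed yet. -/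
def InSystem (lam kap mu : E → ℝ≥0) (f : ℝ≥0 → E) (e z : ℕ → ℝ) (t : ℝ≥0) (k : ℕ) : Prop :=
  arrivalTime lam f e k ≤ t ∧
    ¬ serviceRequirement kap (f (arrivalTime lam f e k).toNNReal) (z k)
        ≤ workDone mu f (arrivalTime lam f e k).toNNReal t

/-- The number `M(t)` of jobs in the system at time `t` (almost surely finite). -/
def numJobs (lam kap mu : E → ℝ≥0) (f : ℝ≥0 → E) (e z : ℕ → ℝ) (t : ℝ≥0) : ℝ≥0∞ :=
  open Classical in ∑' k : ℕ, if InSystem lam kap mu f e z t k then 1 else 0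

/-- The parameter
`φₜ(f) = ∫₀ᵗ λ(f(s)) exp (-κ(f(s)) ∫ₛᵗ μ(f(r)) dr) ds`. -/
def phi (lam kap mu : E → ℝ≥0) (t : ℝ≥0) (f : ℝ≥0 → E) : ℝ :=
  ∫ s in (0 : ℝ)..t, (lam (f s.toNNReal) : ℝ) *
    Real.exp (-((kap (f s.toNNReal) : ℝ) * ∫ r in s..(t : ℝ), (mu (f r.toNNReal) : ℝ)))

variable {Ω : Type*} [MeasurableSpace Ω]

/-- The random objects that drive a modulated infinite-server queue: a background process `J`, a
standard Poisson process with interarrival times `e`, and standard exponential random variables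
`z k`, all of them independent. -/
structure IsQueueInput [TopologicalSpace E] [MeasurableSpace E] (P : Measure Ω)
    (J : ℝ≥0 → Ω → E) (e z : ℕ → Ω → ℝ) : Prop where
  background : IsBackgroundProcess J
  measurable_e : ∀ k, Measurable (e k)
  measurable_z : ∀ k, Measurable (z k)
  map_e : ∀ k, P.map (e k) = expMeasure 1
  map_z : ∀ k, P.map (z k) = expMeasure 1
  iIndep : iIndepFun (Sum.elim e z) P
  indep : IndepFun (fun ω (s : ℝ≥0) => J s ω) (fun ω (i : ℕ ⊕ ℕ) => Sum.elim e z i ω) P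

/-- The law of `Mₙ(t) / n`, where `Mₙ(t)` is the number of jobs at time `t` in the queue
`(J, n λ, κ, μ)`. -/
def scaledLaw (P : Measure Ω) (J : ℝ≥0 → Ω → E) (e z : ℕ → Ω → ℝ) (lam kap mu : E → ℝ≥0)
    (t : ℝ≥0) (n : ℕ) : Measure ℝ :=
  P.map fun ω =>
    (numJobs (fun x => (n : ℝ≥0) * lam x) kap mu (fun s => J s ω) (fun k => e k ω)
      (fun k => z k ω) t).toReal / n

/-- The law of the random parameter `φₜ(J)`. -/
def paramLaw (P : Measure Ω) (J : ℝ≥0 → Ω → E) (lam kap mu : E → ℝ≥0) (t : ℝ≥0) : Measure ℝ :=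
  P.map fun ω => phi lam kap mu t (fun s => J s ω)

end Queue

/-! ### The rate function of the number of jobs -/

/-- The Fenchel-Legendre transform `ℓ(γ; a) = sup_θ (θ a - log E exp (θ X))` of the cumulant
generating function of a Poisson variable `X` with parameter `γ`. (The supremum is nonnegative, as
`θ = 0` contributes `0`.) -/
def ell (γ : ℝ≥0) (a : ℝ) : ℝ≥0∞ :=
  ⨆ θ : ℝ, ENNReal.ofReal (θ * a - cgf (fun k : ℕ => (k : ℝ)) (poissonMeasure γ) θ)

/-- The attainable parameters of the sequence `ν n` of laws of the random parameters. -/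
def attainable (ν : ℕ → Measure ℝ) : Set ℝ≥0 :=
  {γ | ∀ ε : ℝ, 0 < ε → ∃ N : ℕ, ∀ n ≥ N, 0 < ν n (Metric.ball (γ : ℝ) ε)}

/-- The function `I(a) = inf_{γ ∈ R(t)} [ℓ(γ; a) + ψ(γ)]`. -/
def rateI (ν : ℕ → Measure ℝ) (ψ : ℝ → ℝ≥0∞) (a : ℝ) : ℝ≥0∞ :=
  ⨅ γ ∈ attainable ν, (ell γ a + ψ (γ : ℝ))

end ModulatedQueue

end

/-!
Given the path `f` of the background process, the jobs present at time `t` form a thinning of a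
Poisson process by independent exponential marks, so `numJobs` is Poisson with parameter
`n * phi lam kap mu t f`; hence the law of `Mₙ(t) / n` is a mixture, over the law `ν` of `φₜ(J)`, of
scaled Poisson laws. The thinning is proved through exponential moments: for each `θ`, multiplying
the factors `exp θ` of the retained points by the expected contribution of the points still to come
gives a martingale, whose limit identifies the moment generating function.

A constant sequence `ν` satisfies the large deviations principle only with the rate function that
is `0` on the support of `ν` and `∞` elsewhere. Its attainable parameters are the support, which is
compact because `φₜ` is bounded; so `I` is the infimum of `ℓ(γ; ·)` over a compact set of `γ`, and
the principle for the mixtures follows from Chernoff bounds that are uniform in `γ` together with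
the local behaviour of the Poisson weights.

An irreducible chain follows any given càdlàg path, up to an arbitrarily small amount of time spent
in the wrong state, with positive probability. Since `φₜ` is Lipschitz in that amount of time, every
parameter attainable for some background process is attainable for the chain, so its rate function
is the smallest one.
-/

namespace ModulatedQueue

/-! ### Exponential rates -/

/-- The normalised logarithms `(1 / n) log (u n)`, whose upper and lower limits the large deviations
principle controls; the value at `n = 0` is irrelevant. -/
noncomputable abbrev expRate (u : ℕ → ℝ≥0∞) (n : ℕ) : EReal :=
  ((1 / (n : ℝ) : ℝ) : EReal) * ENNReal.log (u n)

section ExpRate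

variable {u : ℕ → ℝ≥0∞} {K : ℝ≥0∞} {x : ℝ}

lemma expRate_le_expRate {v : ℕ → ℝ≥0∞} {n : ℕ} (h : u n ≤ v n) :
    expRate u n ≤ expRate v n :=
  mul_le_mul_of_nonneg_left (ENNReal.log_monotone h) (by positivity)

lemma expRate_zero {n : ℕ} (hn : n ≠ 0) : expRate 0 n = ⊥ := by
  rw [expRate, Pi.zero_apply, ENNReal.log_zero, EReal.coe_mul_bot_of_pos (by positivity)]

lemma tendsto_expRate_const_mul_exp (hK₀ : K ≠ 0) (hK : K ≠ ⊤) (x : ℝ) :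
    Tendsto (expRate fun n => K * ENNReal.ofReal (Real.exp (n * x))) atTop (𝓝 x) := by
  have hKpos : 0 < K.toReal := ENNReal.toReal_pos hK₀ hK
  have hlim : Tendsto (fun n : ℕ => Real.log K.toReal / n + x) atTop (𝓝 x) := by
    simpa using (tendsto_const_div_atTop_nhds_zero_nat (Real.log K.toReal)).add_const x
  refine ((continuous_coe_real_ereal.tendsto x).comp hlim).congr' ?_
  filter_upwards [eventually_ne_atTop 0] with n hn
  rw [Function.comp_apply, expRate, ← ENNReal.ofReal_toReal hK,
    ← ENNReal.ofReal_mul ENNReal.toReal_nonneg, ENNReal.log_ofReal_of_pos (by positivity),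
    Real.log_mul hKpos.ne' (Real.exp_ne_zero _), Real.log_exp, ← EReal.coe_mul,
    ENNReal.toReal_ofReal hKpos.le]
  congr 1
  field_simp

lemma limsup_expRate_le (hK₀ : K ≠ 0) (hK : K ≠ ⊤)
    (h : ∀ᶠ n : ℕ in atTop, u n ≤ K * ENNReal.ofReal (Real.exp (n * x))) :
    limsup (expRate u) atTop ≤ x :=
  (limsup_le_limsup (h.mono fun _ hn => expRate_le_expRate hn)).trans_eq
    (tendsto_expRate_const_mul_exp hK₀ hK x).limsup_eq

lemma le_liminf_expRate (hK₀ : K ≠ 0) (hK : K ≠ ⊤)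
    (h : ∀ᶠ n : ℕ in atTop, K * ENNReal.ofReal (Real.exp (n * x)) ≤ u n) :
    x ≤ liminf (expRate u) atTop :=
  (tendsto_expRate_const_mul_exp hK₀ hK x).liminf_eq.symm.trans_le
    (liminf_le_liminf (h.mono fun _ hn => expRate_le_expRate hn))

lemma limsup_expRate_nonpos (hK : K ≠ ⊤) (h : ∀ n, u n ≤ K) : limsup (expRate u) atTop ≤ 0 := by
  refine limsup_expRate_le (K := K + 1) (x := 0) (by simp) (by simpa using hK)
    (Eventually.of_forall fun n => ?_)
  simpa using (h n).trans le_self_add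

lemma liminf_expRate_const_nonneg (hK₀ : K ≠ 0) (hK : K ≠ ⊤) :
    0 ≤ liminf (expRate fun _ => K) atTop :=
  le_liminf_expRate (x := 0) hK₀ hK (by simp)

end ExpRate

lemma le_neg_coe_of_forall_nnreal_lt {y : EReal} {c : ℝ≥0∞} (hy : y ≤ 0)
    (h : ∀ r : ℝ≥0, (r : ℝ≥0∞) < c → y ≤ ((-r : ℝ) : EReal)) : y ≤ -(c : EReal) := by
  have hcoe : ((-y).toENNReal : EReal) = -y :=
    EReal.coe_toENNReal (by simpa using EReal.neg_le_neg_iff.2 hy)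
  rw [EReal.le_neg, ← hcoe, EReal.coe_ennreal_le_coe_ennreal_iff]
  refine ENNReal.le_of_forall_nnreal_lt fun r hr => ?_
  rw [← EReal.coe_ennreal_le_coe_ennreal_iff, hcoe, EReal.le_neg]
  exact h r hr

lemma neg_coe_le_of_forall_lt_nnreal {y : EReal} {c : ℝ≥0∞}
    (h : ∀ r : ℝ≥0, c < r → ((-r : ℝ) : EReal) ≤ y) : -(c : EReal) ≤ y := by
  have hle : (-y).toENNReal ≤ c := by
    refine le_of_forall_gt_imp_ge_of_dense fun b hb => ?_
    induction b with
    | top => exact le_top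
    | coe r =>
      have hr : -y ≤ ((r : ℝ) : EReal) := EReal.neg_le.1 ((EReal.coe_neg _).symm.trans_le (h r hb))
      simpa using EReal.toENNReal_le_toENNReal hr
  rw [EReal.neg_le]
  calc -y ≤ ((-y).toENNReal : EReal) := by rw [EReal.coe_toENNReal_eq_max]; exact le_max_right _ _
    _ ≤ c := EReal.coe_ennreal_le_coe_ennreal_iff.2 hle

/-! ### Constant sequences of measures -/

section Const

variable {X : Type*} [TopologicalSpace X] [MeasurableSpace X] {ν : Measure X} [IsFiniteMeasure ν]

lemma satisfiesLDP_const [HereditarilyLindelofSpace X] (ν : Measure X) [IsFiniteMeasure ν] :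
    SatisfiesLDP (fun _ => ν) (ν.supportᶜ.indicator fun _ => ⊤) where
  isRateFunction := Measure.isOpen_compl_support.lowerSemicontinuous_indicator zero_le
  upper F _ := by
    rcases (F ∩ ν.support).eq_empty_or_nonempty with hF | ⟨x, hxF, hxν⟩
    · have hνF : ν F = 0 := measure_mono_null
        (Set.disjoint_iff_inter_eq_empty.2 hF).subset_compl_right Measure.measure_compl_support
      have hbot : expRate (fun _ => ν F) =ᶠ[atTop] fun _ => ⊥ := by
        filter_upwards [eventually_ne_atTop 0] with n hn
        rw [hνF]; exact expRate_zero hn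
      exact (limsup_congr hbot).trans_le (by simp)
    · have hinf : ⨅ a ∈ F, ν.supportᶜ.indicator (fun _ => (⊤ : ℝ≥0∞)) a = 0 :=
        le_antisymm (iInf₂_le_of_le x hxF (by simp [hxν])) zero_le
      simpa only [hinf, EReal.coe_ennreal_zero, neg_zero] using
        limsup_expRate_nonpos (measure_ne_top ν F) fun _ => le_rfl
  lower G hG := by
    rcases (G ∩ ν.support).eq_empty_or_nonempty with hGν | ⟨x, hxG, hxν⟩
    · have hinf : ⨅ a ∈ G, ν.supportᶜ.indicator (fun _ => (⊤ : ℝ≥0∞)) a = ⊤ :=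
        iInf₂_eq_top.2 fun a ha => Set.indicator_of_mem
          ((Set.disjoint_iff_inter_eq_empty.2 hGν).subset_compl_right ha) _
      simp [hinf]
    · have hνG : 0 < ν G := (Measure.mem_support_iff_forall x).1 hxν G (hG.mem_nhds hxG)
      have hinf : ⨅ a ∈ G, ν.supportᶜ.indicator (fun _ => (⊤ : ℝ≥0∞)) a = 0 :=
        le_antisymm (iInf₂_le_of_le x hxG (by simp [hxν])) zero_le
      simpa only [hinf, EReal.coe_ennreal_zero, neg_zero] using
        liminf_expRate_const_nonneg hνG.ne' (measure_ne_top ν G)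

lemma SatisfiesLDP.eq_zero_of_mem_support [RegularSpace X] {ψ : X → ℝ≥0∞}
    (h : SatisfiesLDP (fun _ => ν) ψ) {x : X} (hx : x ∈ ν.support) : ψ x = 0 := by
  by_contra hne
  obtain ⟨c, hc₀, hcx⟩ := exists_between (pos_iff_ne_zero.2 hne)
  obtain ⟨F, hFx, hF, hFc⟩ := exists_mem_nhds_isClosed_subset (h.isRateFunction x c hcx)
  have hνF : 0 < ν F := (Measure.mem_support_iff_forall x).1 hx F hFx
  have hle : (0 : EReal) ≤ -((⨅ a ∈ F, ψ a : ℝ≥0∞) : EReal) :=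
    (liminf_expRate_const_nonneg hνF.ne' (measure_ne_top ν F)).trans
      (le_trans liminf_le_limsup (h.upper F hF))
  have hinf : c ≤ ⨅ a ∈ F, ψ a := le_iInf₂ fun a ha => (hFc ha).le
  rw [EReal.le_neg, neg_zero, ← EReal.coe_ennreal_zero, EReal.coe_ennreal_le_coe_ennreal_iff] at hle
  exact (hinf.trans hle).not_gt hc₀

end Const

lemma mem_attainable_const {ν : Measure ℝ} {γ : ℝ≥0} :
    γ ∈ attainable (fun _ => ν) ↔ (γ : ℝ) ∈ ν.support := by
  rw [Metric.nhds_basis_ball.mem_measureSupport]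
  exact forall₂_congr fun ε _ => ⟨fun ⟨N, hN⟩ => hN N le_rfl, fun h => ⟨0, fun _ _ => h⟩⟩

lemma rateI_const {ν : Measure ℝ} [IsFiniteMeasure ν] {ψ : ℝ → ℝ≥0∞}
    (h : SatisfiesLDP (fun _ => ν) ψ) :
    rateI (fun _ => ν) ψ = fun a => ⨅ γ ∈ attainable (fun _ => ν), ell γ a := by
  funext a
  refine biInf_congr fun γ hγ => ?_
  rw [h.eq_zero_of_mem_support (mem_attainable_const.1 hγ), add_zero]

lemma isCompact_attainable_const {ν : Measure ℝ} {C : ℝ} (hν : ∀ᵐ γ ∂ν, γ ∈ Set.Icc 0 C) :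
    IsCompact (attainable fun _ => ν) := by
  have hpre : attainable (fun _ => ν) = ((↑) : ℝ≥0 → ℝ) ⁻¹' ν.support :=
    Set.ext fun γ => mem_attainable_const
  have hsub : ν.support ⊆ Set.Icc 0 C := Measure.support_subset_of_isClosed isClosed_Icc hν
  refine (isCompact_Icc (a := 0) (b := C.toNNReal)).of_isClosed_subset
    (hpre ▸ Measure.isClosed_support.preimage NNReal.continuous_coe) fun γ hγ => ⟨zero_le, ?_⟩
  exact NNReal.le_toNNReal_of_coe_le (hsub (mem_attainable_const.1 hγ)).2

/-! ### The Chernoff bound on closed sets -/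

section Chernoff

variable {Ω : Type*} [MeasurableSpace Ω] {μ : Measure Ω} {X : Ω → ℝ}

lemma integrable_of_forall_integrable_exp_mul
    (hexp : ∀ θ : ℝ, Integrable (fun ω => Real.exp (θ * X ω)) μ) : Integrable X μ := by
  simpa using integrable_pow_of_integrable_exp_mul one_ne_zero (hexp 1) (hexp (-1)) 1

variable [IsProbabilityMeasure μ]

lemma mul_integral_le_cgf {θ : ℝ} (hX : Integrable X μ)
    (hexp : Integrable (fun ω => Real.exp (θ * X ω)) μ) : θ * μ[X] ≤ cgf X μ θ := by
  rw [cgf, Real.le_log_iff_exp_le (mgf_pos hexp), ← integral_const_mul]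
  exact convexOn_exp.map_integral_le Real.continuous_exp.continuousOn isClosed_univ
    (ae_of_all _ fun _ => Set.mem_univ _) (hX.const_mul θ) hexp

lemma measureReal_ge_le_exp_neg {b c θ : ℝ}
    (hexp : ∀ θ : ℝ, Integrable (fun ω => Real.exp (θ * X ω)) μ) (hb : μ[X] ≤ b)
    (hc : c ≤ θ * b - cgf X μ θ) : μ.real {ω | b ≤ X ω} ≤ Real.exp (-c) := by
  rcases le_total 0 θ with hθ | hθ
  · exact (measure_ge_le_exp_cgf b hθ (hexp θ)).trans (Real.exp_le_exp.2 (by linarith))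
  · have hmean := mul_integral_le_cgf (integrable_of_forall_integrable_exp_mul hexp) (hexp θ)
    have hc₀ : c ≤ 0 := by linarith [mul_le_mul_of_nonpos_left hb hθ]
    exact measureReal_le_one.trans (Real.one_le_exp (neg_nonneg.2 hc₀))

lemma measureReal_inter_Ici_le_exp_neg {F : Set ℝ} {c : ℝ} (hF : IsClosed F)
    (hexp : ∀ θ : ℝ, Integrable (fun ω => Real.exp (θ * X ω)) μ)
    (hc : ∀ b ∈ F, ∃ θ, c ≤ θ * b - cgf X μ θ) :
    μ.real (X ⁻¹' (F ∩ Set.Ici μ[X])) ≤ Real.exp (-c) := by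
  rcases (F ∩ Set.Ici μ[X]).eq_empty_or_nonempty with h | h
  · simpa [h] using Real.exp_nonneg _
  · have hbdd : BddBelow (F ∩ Set.Ici μ[X]) := ⟨μ[X], fun x hx => hx.2⟩
    obtain ⟨hsF, hs⟩ := (hF.inter isClosed_Ici).csInf_mem h hbdd
    obtain ⟨θ, hθ⟩ := hc _ hsF
    have hsub : X ⁻¹' (F ∩ Set.Ici μ[X]) ⊆ {ω | sInf (F ∩ Set.Ici μ[X]) ≤ X ω} :=
      fun ω hω => csInf_le hbdd hω
    exact (measureReal_mono hsub).trans (measureReal_ge_le_exp_neg hexp hs hθ)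

theorem measureReal_preimage_isClosed_le {F : Set ℝ} {c : ℝ} (hF : IsClosed F)
    (hexp : ∀ θ : ℝ, Integrable (fun ω => Real.exp (θ * X ω)) μ)
    (hc : ∀ b ∈ F, ∃ θ, c ≤ θ * b - cgf X μ θ) :
    μ.real (X ⁻¹' F) ≤ 2 * Real.exp (-c) := by
  have hright := measureReal_inter_Ici_le_exp_neg hF hexp hc
  have hleft : μ.real ((-X) ⁻¹' (-F ∩ Set.Ici μ[-X])) ≤ Real.exp (-c) := by
    refine measureReal_inter_Ici_le_exp_neg hF.neg (fun θ => by simpa using hexp (-θ))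
      fun b hb => ?_
    obtain ⟨θ, hθ⟩ := hc (-b) hb
    exact ⟨-θ, by rwa [cgf_neg, neg_neg, neg_mul, ← mul_neg]⟩
  have hcover : X ⁻¹' F ⊆ X ⁻¹' (F ∩ Set.Ici μ[X]) ∪ (-X) ⁻¹' (-F ∩ Set.Ici μ[-X]) := by
    intro ω hω
    rcases le_total μ[X] (X ω) with h | h
    · exact Or.inl ⟨hω, h⟩
    · exact Or.inr ⟨by simpa using hω, by simpa [integral_neg] using h⟩
  linarith [(measureReal_mono (μ := μ) hcover).trans (measureReal_union_le _ _)]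

end Chernoff

/-! ### The Poisson distribution and its Legendre transform -/

section Poisson

lemma hasSum_poisson_mul_exp (r : ℝ≥0) (θ : ℝ) :
    HasSum (fun k : ℕ => Real.exp (-r) * (r : ℝ) ^ k / k.factorial * Real.exp (θ * k))
      (Real.exp (r * (Real.exp θ - 1))) := by
  have hsum := (NormedSpace.expSeries_div_hasSum_exp ((r : ℝ) * Real.exp θ)).mul_left
    (Real.exp (-r))
  rw [← Real.exp_eq_exp_ℝ, ← Real.exp_add] at hsum
  rw [show (r : ℝ) * (Real.exp θ - 1) = -r + r * Real.exp θ by ring]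
  refine hsum.congr_fun fun k => ?_
  rw [mul_pow, ← Real.exp_nat_mul, mul_comm θ]
  ring

lemma integrable_exp_mul_poissonMeasure (r : ℝ≥0) (θ : ℝ) :
    Integrable (fun k : ℕ => Real.exp (θ * k)) (poissonMeasure r) := by
  rw [integrable_poissonMeasure_iff]
  simpa using (hasSum_poisson_mul_exp r θ).summable

lemma mgf_poissonMeasure (r : ℝ≥0) (θ : ℝ) :
    mgf (fun k : ℕ => (k : ℝ)) (poissonMeasure r) θ = Real.exp (r * (Real.exp θ - 1)) := by
  rw [mgf, integral_poissonMeasure]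
  simp only [smul_eq_mul]
  exact (hasSum_poisson_mul_exp r θ).tsum_eq

lemma cgf_poissonMeasure (r : ℝ≥0) (θ : ℝ) :
    cgf (fun k : ℕ => (k : ℝ)) (poissonMeasure r) θ = r * (Real.exp θ - 1) := by
  rw [cgf, mgf_poissonMeasure, Real.log_exp]

lemma measurable_poissonMeasure : Measurable poissonMeasure := by
  refine Measure.measurable_of_measurable_coe _ fun s _ => ?_
  have happly (r : ℝ≥0) : poissonMeasure r s
      = ∑' k : ℕ,
        s.indicator (fun k => ENNReal.ofReal (Real.exp (-r) * r ^ k / k.factorial)) k := by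
    rw [← Measure.tsum_indicator_apply_singleton _ _ .of_discrete]
    simp only [poissonMeasure_singleton]
  simp only [happly]
  refine Measurable.tsum fun k => ?_
  by_cases hk : k ∈ s
  · simp only [Set.indicator_of_mem hk]; fun_prop
  · simp only [Set.indicator_of_notMem hk]; fun_prop

lemma ell_eq (γ : ℝ≥0) (a : ℝ) :
    ell γ a = ⨆ θ : ℝ, ENNReal.ofReal (θ * a - γ * (Real.exp θ - 1)) := by
  simp only [ell, cgf_poissonMeasure]

lemma ell_le_coe_iff {γ c : ℝ≥0} {a : ℝ} :
    ell γ a ≤ c ↔ ∀ θ : ℝ, θ * a - γ * (Real.exp θ - 1) ≤ c := by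
  simp only [ell_eq, iSup_le_iff, ENNReal.ofReal_le_iff_le_toReal ENNReal.coe_ne_top,
    ENNReal.coe_toReal]

lemma lowerSemicontinuous_ell : LowerSemicontinuous fun p : ℝ≥0 × ℝ => ell p.1 p.2 := by
  simp only [ell_eq]
  exact lowerSemicontinuous_iSup fun θ =>
    (ENNReal.continuous_ofReal.comp (by fun_prop)).lowerSemicontinuous

lemma le_of_ell_zero_le {γ c : ℝ≥0} (h : ell γ 0 ≤ c) : γ ≤ c := by
  have hlim : Tendsto (fun θ : ℝ => θ * 0 - γ * (Real.exp θ - 1)) atBot (𝓝 γ) := by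
    simpa using (Real.tendsto_exp_atBot.sub_const 1).const_mul (-γ : ℝ)
  exact_mod_cast le_of_tendsto' hlim (ell_le_coe_iff.1 h)

lemma nonneg_of_ell_le {γ c : ℝ≥0} {a : ℝ} (h : ell γ a ≤ c) : 0 ≤ a := by
  by_contra! ha
  have hexp : Real.exp ((c + 1) / a) ≤ 1 :=
    Real.exp_le_one_iff.2 (div_nonpos_of_nonneg_of_nonpos (by positivity) ha.le)
  have hθ := ell_le_coe_iff.1 h ((c + 1) / a)
  rw [div_mul_cancel₀ _ ha.ne] at hθ
  linarith [mul_nonpos_of_nonneg_of_nonpos γ.coe_nonneg (sub_nonpos.2 hexp)]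

lemma pos_of_ell_le {γ c : ℝ≥0} {a : ℝ} (ha : 0 < a) (h : ell γ a ≤ c) : 0 < γ := by
  by_contra! hγ
  obtain rfl : γ = 0 := nonpos_iff_eq_zero.1 hγ
  have hθ := ell_le_coe_iff.1 h ((c + 1) / a)
  rw [div_mul_cancel₀ _ ha.ne', NNReal.coe_zero] at hθ
  linarith

lemma mul_log_sub_le_of_ell_le {γ c : ℝ≥0} {a : ℝ} (ha : 0 < a) (h : ell γ a ≤ c) :
    a * Real.log a - a * Real.log γ - a + γ ≤ c := by
  have hγ : (0 : ℝ) < γ := by exact_mod_cast pos_of_ell_le ha h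
  have hθ := ell_le_coe_iff.1 h (Real.log (a / γ))
  rw [Real.exp_log (by positivity), Real.log_div ha.ne' hγ.ne', mul_sub (γ : ℝ),
    mul_div_cancel₀ _ hγ.ne'] at hθ
  linarith

lemma tendsto_log_pow_div_factorial {a : ℝ} (ha : 0 < a) :
    Tendsto (fun n : ℕ => (⌊a * n⌋₊ * Real.log n - Real.log (⌊a * n⌋₊.factorial : ℝ)) / n) atTop
      (𝓝 (a - a * Real.log a)) := by
  have hk : Tendsto (fun n : ℕ => (⌊a * n⌋₊ : ℝ) / n) atTop (𝓝 a) :=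
    (tendsto_nat_floor_mul_div_atTop ha.le).comp tendsto_natCast_atTop_atTop
  have hk' : Tendsto (fun n : ℕ => ⌊a * n⌋₊) atTop atTop :=
    tendsto_nat_floor_atTop.comp (tendsto_natCast_atTop_atTop.const_mul_atTop ha)
  have hinv : Tendsto (fun n : ℕ => (1 : ℝ) / n) atTop (𝓝 0) :=
    tendsto_const_div_atTop_nhds_zero_nat 1
  have hstirling : Tendsto (fun n : ℕ => Real.log (Stirling.stirlingSeq ⌊a * n⌋₊)) atTop
      (𝓝 (Real.log (√Real.pi))) :=
    ((Real.continuousAt_log (Real.sqrt_ne_zero'.2 Real.pi_pos)).tendsto.comp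
      Stirling.tendsto_stirlingSeq_sqrt_pi).comp hk'
  have hkr : Tendsto (fun n : ℕ => (⌊a * n⌋₊ : ℝ)) atTop atTop :=
    tendsto_natCast_atTop_atTop.comp hk'
  have hlog : Tendsto (fun n : ℕ => Real.log (2 * ⌊a * n⌋₊) / (2 * ⌊a * n⌋₊)) atTop (𝓝 0) :=
    (Real.isLittleO_log_id_atTop.tendsto_div_nhds_zero).comp (hkr.const_mul_atTop two_pos)
  have hmain := ((hk.sub (hk.mul ((Real.continuousAt_log ha.ne').tendsto.comp hk))).sub
    (hlog.mul hk)).sub (hstirling.mul hinv)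
  rw [zero_mul, mul_zero, sub_zero, sub_zero] at hmain
  refine hmain.congr' ?_
  filter_upwards [hk'.eventually_gt_atTop 0, eventually_gt_atTop 0] with n hk0 hn
  have hk0' : (0 : ℝ) < ⌊a * n⌋₊ := by exact_mod_cast hk0
  have hn' : (0 : ℝ) < n := by exact_mod_cast hn
  have hformula := Stirling.log_stirlingSeq_formula ⌊a * n⌋₊
  rw [Real.log_div hk0'.ne' (Real.exp_pos 1).ne', Real.log_exp] at hformula
  simp only [Function.comp]
  rw [Real.log_div hk0'.ne' hn'.ne', hformula]
  field_simp
  ring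

end Poisson

/-! ### Infima of Legendre transforms -/

section RateFunction

variable {R : Set ℝ≥0}

lemma lowerSemicontinuous_iInf_ell (hR : IsCompact R) :
    LowerSemicontinuous fun a => ⨅ γ ∈ R, ell γ a := by
  intro a c hc
  obtain ⟨d, hcd, hd⟩ := exists_between hc
  have hopen : IsOpen {p : ℝ≥0 × ℝ | d < ell p.1 p.2} := lowerSemicontinuous_ell.isOpen_preimage d
  have hsub : R ×ˢ {a} ⊆ {p : ℝ≥0 × ℝ | d < ell p.1 p.2} := by
    rintro ⟨γ, b⟩ ⟨hγ, rfl⟩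
    exact hd.trans_le (iInf₂_le γ hγ)
  obtain ⟨U, V, -, hV, hRU, haV, hUV⟩ := generalized_tube_lemma hR isCompact_singleton hopen hsub
  filter_upwards [hV.mem_nhds (haV rfl)] with b hb
  exact hcd.trans_le (le_iInf₂ fun γ hγ => (hUV (Set.mk_mem_prod (hRU hγ) hb)).le)

lemma mem_Icc_of_ell_le {γ c : ℝ≥0} {C : ℝ} (hγ : (γ : ℝ) ≤ C) {a : ℝ} (h : ell γ a ≤ c) :
    a ∈ Set.Icc 0 (c + C * (Real.exp 1 - 1)) := by
  have hθ := ell_le_coe_iff.1 h 1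
  have hmul : (γ : ℝ) * (Real.exp 1 - 1) ≤ C * (Real.exp 1 - 1) :=
    mul_le_mul_of_nonneg_right hγ (sub_nonneg.2 (Real.one_le_exp zero_le_one))
  exact ⟨nonneg_of_ell_le h, by linarith⟩

theorem isGoodRateFunction_iInf_ell (hR : IsCompact R) :
    IsGoodRateFunction fun a => ⨅ γ ∈ R, ell γ a := by
  refine ⟨lowerSemicontinuous_iInf_ell hR, fun c => ?_⟩
  obtain ⟨C, hC⟩ := hR.bddAbove
  refine
    (isCompact_Icc (a := 0) (b := ((c + 1 : ℝ≥0) : ℝ) + C * (Real.exp 1 - 1))).of_isClosed_subset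
    ((lowerSemicontinuous_iInf_ell hR).isClosed_preimage c) fun a ha => ?_
  have hlt : ⨅ γ ∈ R, ell γ a < (c + 1 : ℝ≥0) := ha.trans_lt (by exact_mod_cast lt_add_one c)
  simp only [iInf_lt_iff] at hlt
  obtain ⟨γ, hγ, h⟩ := hlt
  exact mem_Icc_of_ell_le (hC hγ) h.le

end RateFunction

/-! ### Mixtures of scaled Poisson distributions -/

section ScaledPoisson

variable {n : ℕ} {γ c : ℝ≥0} {a : ℝ}

lemma measureReal_poissonMeasure_div_mem_le {F : Set ℝ} (hn : n ≠ 0) (hF : IsClosed F)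
    (hc : ∀ b ∈ F, (c : ℝ≥0∞) < ell γ b) :
    (poissonMeasure (n * γ)).real ((fun k : ℕ => (k : ℝ) / n) ⁻¹' F)
      ≤ 2 * Real.exp (-(n * c)) := by
  have hscale (θ : ℝ) : (fun k : ℕ => Real.exp (θ * ((k : ℝ) / n)))
      = fun k : ℕ => Real.exp (θ / n * k) := by
    ext k; ring_nf
  have hn₀ : (0 : ℝ) < n := by positivity
  refine measureReal_preimage_isClosed_le hF
    (fun θ => by simpa only [hscale] using integrable_exp_mul_poissonMeasure (n * γ) (θ / n))
    fun b hb => ?_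
  have hlt := hc b hb
  simp only [ell_eq, lt_iSup_iff, ← ENNReal.ofReal_coe_nnreal, ENNReal.ofReal_lt_ofReal_iff'] at hlt
  obtain ⟨θ, hθ, -⟩ := hlt
  refine ⟨n * θ, ?_⟩
  have hcgf : cgf (fun k : ℕ => (k : ℝ) / n) (poissonMeasure (n * γ)) (n * θ)
      = n * (γ * (Real.exp θ - 1)) := by
    rw [cgf, mgf, hscale, mul_div_cancel_left₀ _ hn₀.ne', ← mgf, ← cgf, cgf_poissonMeasure]
    push_cast; ring
  rw [hcgf, mul_assoc, ← mul_sub]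
  exact mul_le_mul_of_nonneg_left hθ.le hn₀.le

lemma measureReal_poissonMeasure_singleton (r : ℝ≥0) (k : ℕ) :
    (poissonMeasure r).real {k} = Real.exp (-r) * r ^ k / k.factorial := by
  rw [measureReal_def, poissonMeasure_singleton, ENNReal.toReal_ofReal (by positivity)]

lemma measureReal_poissonMeasure_singleton_eq_exp (hn : n ≠ 0) (hγ : 0 < γ) (k : ℕ) :
    (poissonMeasure (n * γ)).real {k}
      = Real.exp (n * (-γ + k / n * Real.log γ + (k * Real.log n - Real.log k.factorial) / n)) := by
  have hγ₀ : (0 : ℝ) < γ := hγ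
  have hn₀ : (0 : ℝ) < n := by positivity
  have hexponent :
      n * (-γ + k / n * Real.log γ + (k * Real.log n - Real.log k.factorial) / n)
        = -(n * γ) + k * Real.log (n * γ) - Real.log (k.factorial : ℝ) := by
    rw [Real.log_mul hn₀.ne' hγ₀.ne']; field_simp; ring
  rw [measureReal_poissonMeasure_singleton, hexponent, Real.exp_sub, Real.exp_add,
    Real.exp_nat_mul, Real.exp_log (by positivity), Real.exp_log (by positivity)]
  push_cast; rfl

lemma tendsto_natFloor_mul_div (ha : 0 ≤ a) :
    Tendsto (fun n : ℕ => (⌊a * n⌋₊ : ℝ) / n) atTop (𝓝 a) :=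
  (tendsto_nat_floor_mul_div_atTop ha).comp tendsto_natCast_atTop_atTop

lemma eventually_exp_neg_le_poissonMeasure_of_pos (ha : 0 < a) (h : ell γ a < c) :
    ∀ᶠ p : ℕ × ℝ≥0 in atTop ×ˢ 𝓝 γ,
      Real.exp (p.1 * -c) ≤ (poissonMeasure (p.1 * p.2)).real {⌊a * p.1⌋₊} := by
  obtain ⟨d, hd, hdc⟩ := ENNReal.lt_iff_exists_nnreal_btwn.1 h
  have hγ : 0 < γ := pos_of_ell_le ha hd.le
  have hlog : Tendsto (fun x : ℝ≥0 => Real.log x) (𝓝 γ) (𝓝 (Real.log γ)) :=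
    (Real.continuousAt_log (by exact_mod_cast hγ.ne')).tendsto.comp
      NNReal.continuous_coe.continuousAt
  have hlim : Tendsto (fun p : ℕ × ℝ≥0 => -(p.2 : ℝ) + (⌊a * p.1⌋₊ : ℝ) / p.1 * Real.log p.2
      + (⌊a * p.1⌋₊ * Real.log p.1 - Real.log (⌊a * p.1⌋₊.factorial : ℝ)) / p.1) (atTop ×ˢ 𝓝 γ)
      (𝓝 (-γ + a * Real.log γ + (a - a * Real.log a))) :=
    (((NNReal.continuous_coe.tendsto γ).neg.comp tendsto_snd).add
      (((tendsto_natFloor_mul_div ha.le).comp tendsto_fst).mul (hlog.comp tendsto_snd))).add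
      ((tendsto_log_pow_div_factorial ha).comp tendsto_fst)
  have hlt : -(c : ℝ) < -γ + a * Real.log γ + (a - a * Real.log a) := by
    have hdc' : (d : ℝ) < c := by exact_mod_cast hdc
    linarith [mul_log_sub_le_of_ell_le ha hd.le]
  filter_upwards [hlim.eventually_const_lt hlt,
    tendsto_fst.eventually (eventually_ne_atTop (0 : ℕ)),
    tendsto_snd.eventually (lt_mem_nhds hγ)] with p hp hn hpos
  rw [measureReal_poissonMeasure_singleton_eq_exp hn hpos]
  exact Real.exp_le_exp.2 (mul_le_mul_of_nonneg_left hp.le (Nat.cast_nonneg _))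

lemma eventually_exp_neg_le_poissonMeasure (h : ell γ a < c) :
    ∀ᶠ p : ℕ × ℝ≥0 in atTop ×ˢ 𝓝 γ,
      Real.exp (p.1 * -c) ≤ (poissonMeasure (p.1 * p.2)).real {⌊a * p.1⌋₊} := by
  rcases (nonneg_of_ell_le h.le).eq_or_lt with rfl | ha
  · obtain ⟨d, hd, hdc⟩ := ENNReal.lt_iff_exists_nnreal_btwn.1 h
    have hγ : γ < c := (le_of_ell_zero_le hd.le).trans_lt (by exact_mod_cast hdc)
    filter_upwards [tendsto_snd.eventually (gt_mem_nhds hγ)] with p hp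
    rw [zero_mul, Nat.floor_zero, measureReal_poissonMeasure_singleton, pow_zero, mul_one,
      Nat.factorial_zero, Nat.cast_one, div_one, Real.exp_le_exp, mul_neg, neg_le_neg_iff]
    push_cast
    gcongr
  · exact eventually_exp_neg_le_poissonMeasure_of_pos ha h

end ScaledPoisson

/-- The distribution of `N / n` for `N` Poisson with parameter `n γ`; it is `dirac 0` for `n = 0`,
where `N / n = 0`. -/
noncomputable def scaledPoisson (n : ℕ) (γ : ℝ≥0) : Measure ℝ :=
  (poissonMeasure (n * γ)).map fun k : ℕ => (k : ℝ) / n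

/-- The distribution of `N / n` for `N` mixed Poisson with parameter `n Γ`, where `Γ` has
distribution `ν`. Negative parameters are truncated to `0`. -/
noncomputable def poissonMixture (ν : Measure ℝ) (n : ℕ) : Measure ℝ :=
  ν.bind fun γ => scaledPoisson n γ.toNNReal

section Mixture

variable {ν : Measure ℝ} {n : ℕ} {B : Set ℝ}

lemma scaledPoisson_apply (γ : ℝ≥0) (hB : MeasurableSet B) :
    scaledPoisson n γ B = poissonMeasure (n * γ) ((fun k : ℕ => (k : ℝ) / n) ⁻¹' B) :=
  Measure.map_apply .of_discrete hB

instance (n : ℕ) (γ : ℝ≥0) : IsProbabilityMeasure (scaledPoisson n γ) :=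
  Measure.isProbabilityMeasure_map Measurable.of_discrete.aemeasurable

lemma measurable_scaledPoisson (n : ℕ) : Measurable (scaledPoisson n) :=
  (Measure.measurable_map _ .of_discrete).comp
    (measurable_poissonMeasure.comp (measurable_const.mul measurable_id))

lemma poissonMixture_apply (hB : MeasurableSet B) :
    poissonMixture ν n B = ∫⁻ γ, scaledPoisson n γ.toNNReal B ∂ν :=
  Measure.bind_apply hB ((measurable_scaledPoisson n).comp measurable_real_toNNReal).aemeasurable

lemma poissonMixture_le_measure_univ (B : Set ℝ) : poissonMixture ν n B ≤ ν Set.univ := by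
  refine (measure_mono (Set.subset_univ B)).trans ?_
  simp [poissonMixture_apply MeasurableSet.univ]

lemma poissonMixture_le_of_isClosed {F : Set ℝ} {c : ℝ≥0} (hF : IsClosed F) (hn : n ≠ 0)
    (hν : ∀ᵐ γ ∂ν, 0 ≤ γ)
    (hc : ∀ γ ∈ attainable (fun _ => ν), ∀ b ∈ F, (c : ℝ≥0∞) < ell γ b) :
    poissonMixture ν n F ≤ 2 * ν Set.univ * ENNReal.ofReal (Real.exp (n * -c)) := by
  rw [poissonMixture_apply hF.measurableSet]
  calc ∫⁻ γ, scaledPoisson n γ.toNNReal F ∂ν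
      ≤ ∫⁻ _, ENNReal.ofReal (2 * Real.exp (n * -c)) ∂ν := by
        refine lintegral_mono_ae ?_
        filter_upwards [hν, Measure.support_mem_ae] with γ hγ hsupp
        lift γ to ℝ≥0 using hγ
        rw [Real.toNNReal_coe, scaledPoisson_apply _ hF.measurableSet, ← ofReal_measureReal,
          mul_neg]
        exact ENNReal.ofReal_le_ofReal (measureReal_poissonMeasure_div_mem_le hn hF
          (hc γ (mem_attainable_const.2 hsupp)))
    _ = _ := by
        rw [lintegral_const, ENNReal.ofReal_mul zero_le_two, ENNReal.ofReal_ofNat, mul_right_comm]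

lemma exists_eventually_le_poissonMixture {G : Set ℝ} (hG : IsOpen G)
    {γ c : ℝ≥0} {a : ℝ} (hγ : (γ : ℝ) ∈ ν.support) (ha : a ∈ G) (h : ell γ a < c) :
    ∃ A : Set ℝ, 0 < ν A ∧ ∀ᶠ n : ℕ in atTop,
      ν A * ENNReal.ofReal (Real.exp (n * -c)) ≤ poissonMixture ν n G := by
  obtain ⟨P, hP, Q, hQ, hPQ⟩ := eventually_prod_iff.1 (eventually_exp_neg_le_poissonMeasure h)
  have hQ' : ∀ᶠ x : ℝ in 𝓝 γ, Q x.toNNReal :=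
    (continuous_real_toNNReal.tendsto (γ : ℝ)).eventually (by rwa [Real.toNNReal_coe])
  obtain ⟨A, hAQ, hAopen, hγA⟩ := mem_nhds_iff.1 hQ'
  refine ⟨A, (Measure.mem_support_iff_forall _).1 hγ A (hAopen.mem_nhds hγA), ?_⟩
  have hfloor := (tendsto_natFloor_mul_div (nonneg_of_ell_le h.le)).eventually (hG.mem_nhds ha)
  filter_upwards [hP, hfloor] with n hn hnG
  rw [poissonMixture_apply hG.measurableSet, mul_comm]
  calc ENNReal.ofReal (Real.exp (n * -c)) * ν A
      = ∫⁻ _ in A, ENNReal.ofReal (Real.exp (n * -c)) ∂ν := by simp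
    _ ≤ ∫⁻ x in A, scaledPoisson n x.toNNReal G ∂ν := by
        refine setLIntegral_mono' hAopen.measurableSet fun x hx => ?_
        rw [scaledPoisson_apply _ hG.measurableSet]
        refine (ENNReal.ofReal_le_ofReal (hPQ hn (hAQ hx))).trans ?_
        rw [ofReal_measureReal]
        exact measure_mono (Set.singleton_subset_iff.2 hnG)
    _ ≤ _ := setLIntegral_le_lintegral _ _

theorem satisfiesLDP_poissonMixture [IsProbabilityMeasure ν] {C : ℝ}
    (hν : ∀ᵐ γ ∂ν, γ ∈ Set.Icc 0 C) :
    SatisfiesLDP (poissonMixture ν) (fun a => ⨅ γ ∈ attainable (fun _ => ν), ell γ a) where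
  isRateFunction := lowerSemicontinuous_iInf_ell (isCompact_attainable_const hν)
  upper F hF := by
    refine le_neg_coe_of_forall_nnreal_lt
      (limsup_expRate_nonpos (measure_ne_top ν Set.univ)
        fun n => poissonMixture_le_measure_univ F) fun r hr => ?_
    refine limsup_expRate_le (K := 2 * ν Set.univ) (by simp) (by simp) ?_
    filter_upwards [eventually_ne_atTop 0] with n hn
    exact poissonMixture_le_of_isClosed hF hn (hν.mono fun γ h => h.1)
      fun γ hγ b hb => hr.trans_le ((iInf₂_le b hb).trans (iInf₂_le γ hγ))
  lower G hG := by
    refine neg_coe_le_of_forall_lt_nnreal fun r hr => ?_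
    simp only [iInf_lt_iff] at hr
    obtain ⟨a, ha, γ, hγ, h⟩ := hr
    obtain ⟨A, hA, hle⟩ := exists_eventually_le_poissonMixture hG
      (mem_attainable_const.1 hγ) ha h
    exact le_liminf_expRate hA.ne' (measure_ne_top ν A) hle

end Mixture

/-! ### Right-continuous paths -/

lemma countable_setOf_not_continuousAt_of_right {ι E : Type*} [LinearOrder ι] [TopologicalSpace ι]
    [OrderTopology ι] [SecondCountableTopology ι] [TopologicalSpace E] [DiscreteTopology E]
    {f : ι → E} (hf : ∀ t, ContinuousWithinAt f (Set.Ici t) t) :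
    {t | ¬ ContinuousAt f t}.Countable := by
  -- The path is constant just after `t`, so discontinuities are isolated from the right.
  refine (countable_setOfPred_isolated_right_within (s := {t | ¬ ContinuousAt f t})).mono
    fun t ht => ?_
  refine ⟨ht, ?_⟩
  have hconst : ∀ᶠ y in 𝓝[>] t, f y = f t := by
    have hright := hf t
    rw [ContinuousWithinAt, nhds_discrete E, tendsto_pure] at hright
    exact hright.filter_mono (nhdsWithin_mono _ Set.Ioi_subset_Ici_self)
  have hcont : ∀ᶠ y in 𝓝[>] t, ContinuousAt f y := by
    filter_upwards [eventually_eventually_nhdsWithin.2 hconst, self_mem_nhdsWithin] with y hy hty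
    rw [IsOpen.nhdsWithin_eq isOpen_Ioi hty] at hy
    rw [ContinuousAt, nhds_discrete E, tendsto_pure]
    exact hy.mono fun w hw => hw.trans hy.self_of_nhds.symm
  rw [← empty_mem_iff_bot]
  filter_upwards [hcont.filter_mono (nhdsWithin_mono _ Set.inter_subset_right),
    self_mem_nhdsWithin] with y hcy hyt
  exact hyt.1 hcy

/-- The `i`-th point of the grid of mesh `1 / (N + 1)`. -/
noncomputable def gridTime (N i : ℕ) : ℝ≥0 := i / (N + 1)

/-- The index of the last grid point before time `v`. -/
noncomputable def gridIndex (N : ℕ) (v : ℝ≥0) : ℕ := ⌊v * (N + 1)⌋₊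

section Grid

variable (N : ℕ) (v : ℝ≥0)

lemma gridTime_zero : gridTime N 0 = 0 := by simp [gridTime]

lemma strictMono_gridTime : StrictMono (gridTime N) := fun i j hij => by
  unfold gridTime
  gcongr

lemma monotone_gridIndex : Monotone (gridIndex N) := fun u v huv => by
  unfold gridIndex
  gcongr

lemma coe_gridTime_succ_sub (i : ℕ) :
    (gridTime N (i + 1) : ℝ) - gridTime N i = 1 / ((N : ℝ) + 1) := by
  simp only [gridTime]
  push_cast
  ring

lemma gridTime_gridIndex_le : gridTime N (gridIndex N v) ≤ v := by
  rw [gridTime, div_le_iff₀ (by positivity)]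
  exact Nat.floor_le zero_le

lemma le_gridTime_gridIndex_succ : v ≤ gridTime N (gridIndex N v + 1) := by
  rw [gridTime, gridIndex, le_div_iff₀ (by positivity), Nat.cast_add_one]
  exact (Nat.lt_floor_add_one _).le

lemma tendsto_sub_gridTime_gridIndex :
    Tendsto (fun N => (v : ℝ) - gridTime N (gridIndex N v)) atTop (𝓝 0) := by
  refine squeeze_zero (fun N => sub_nonneg.2 (NNReal.coe_le_coe.2 (gridTime_gridIndex_le N v)))
    (fun N => ?_) tendsto_one_div_add_atTop_nhds_zero_nat
  rw [← coe_gridTime_succ_sub N (gridIndex N v)]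
  exact sub_le_sub_right (NNReal.coe_le_coe.2 (le_gridTime_gridIndex_succ N v)) _

lemma tendsto_gridTime_gridIndex_succ_sub :
    Tendsto (fun N => (gridTime N (gridIndex N v + 1) : ℝ) - v) atTop (𝓝 0) := by
  refine squeeze_zero (fun N => sub_nonneg.2 (NNReal.coe_le_coe.2 (le_gridTime_gridIndex_succ N v)))
    (fun N => ?_) tendsto_one_div_add_atTop_nhds_zero_nat
  rw [← coe_gridTime_succ_sub N (gridIndex N v)]
  exact sub_le_sub_left (NNReal.coe_le_coe.2 (gridTime_gridIndex_le N v)) _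

lemma tendsto_gridTime_gridIndex :
    Tendsto (fun N => gridTime N (gridIndex N v)) atTop (𝓝 v) := by
  rw [← NNReal.tendsto_coe]
  simpa using (tendsto_sub_gridTime_gridIndex v).const_sub (v : ℝ)

lemma tendsto_gridTime_gridIndex_succ :
    Tendsto (fun N => gridTime N (gridIndex N v + 1)) atTop (𝓝 v) := by
  rw [← NNReal.tendsto_coe]
  simpa using (tendsto_gridTime_gridIndex_succ_sub v).add_const (v : ℝ)

end Grid

section Measurability

variable {Ω E : Type*} [MeasurableSpace Ω] [TopologicalSpace E] [MeasurableSpace E] [BorelSpace E]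

lemma measurable_uncurry_of_right_continuous [TopologicalSpace.PseudoMetrizableSpace E]
    {J : ℝ≥0 → Ω → E} (hJ : ∀ s, Measurable (J s))
    (hright : ∀ ω s, ContinuousWithinAt (fun s => J s ω) (Set.Ici s) s) :
    Measurable (Function.uncurry J) := by
  refine measurable_of_tendsto_metrizable
    (f := fun N (p : ℝ≥0 × Ω) => J (gridTime N (gridIndex N p.1 + 1)) p.2) (fun N => ?_)
    (tendsto_pi_nhds.2 fun p => ?_)
  · have hgrid : Measurable (fun p : ℕ × Ω => J (gridTime N (p.1 + 1)) p.2) :=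
      measurable_from_prod_countable_right fun k => hJ (gridTime N (k + 1))
    have hindex : Measurable (gridIndex N) := Nat.measurable_floor.comp (measurable_id.mul_const _)
    exact hgrid.comp ((hindex.comp measurable_fst).prodMk measurable_snd)
  · exact (hright p.2 p.1).tendsto.comp (tendsto_nhdsWithin_iff.2
      ⟨tendsto_gridTime_gridIndex_succ p.1,
        Eventually.of_forall fun N => le_gridTime_gridIndex_succ N p.1⟩)

variable [TopologicalSpace.PseudoMetrizableSpace E]

lemma IsBackgroundProcess.measurable_uncurry {J : ℝ≥0 → Ω → E} (hJ : IsBackgroundProcess J) :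
    Measurable (Function.uncurry J) :=
  measurable_uncurry_of_right_continuous hJ.measurable fun ω s => (hJ.cadlag ω s).1

lemma IsCadlag.measurable {f : ℝ≥0 → E} (hf : IsCadlag f) : Measurable f :=
  (measurable_uncurry_of_right_continuous (Ω := Unit) (J := fun s _ => f s)
    (fun _ => measurable_const) fun _ s => (hf s).1).comp
      (measurable_id.prodMk (measurable_const (a := ())))

lemma stronglyMeasurable_intervalIntegral {F : Type*} [NormedAddCommGroup F] [NormedSpace ℝ F]
    {μ : Measure ℝ} [SFinite μ] {g : Ω → ℝ → F} {a b : Ω → ℝ}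
    (hg : StronglyMeasurable (Function.uncurry g)) (ha : Measurable a) (hb : Measurable b) :
    StronglyMeasurable (fun ω => ∫ r in (a ω)..(b ω), g ω r ∂μ) := by
  have hIoc {a b : Ω → ℝ} (ha : Measurable a) (hb : Measurable b) :
      StronglyMeasurable (fun ω => ∫ r in Set.Ioc (a ω) (b ω), g ω r ∂μ) := by
    have hS : MeasurableSet {p : Ω × ℝ | a p.1 < p.2 ∧ p.2 ≤ b p.1} :=
      (measurableSet_lt (ha.comp measurable_fst) measurable_snd).inter
        (measurableSet_le measurable_snd (hb.comp measurable_fst))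
    simp only [← integral_indicator measurableSet_Ioc]
    exact (hg.indicator hS).integral_prod_right'
  exact (hIoc ha hb).sub (hIoc hb ha)

end Measurability

/-! ### The random parameter -/

/-- The rate at which jobs arrive at time `s` that are still present at time `t`; its integral is
`phi`. -/
noncomputable def retainedRate {E : Type*} (lam kap mu : E → ℝ≥0) (t : ℝ≥0) (f : ℝ≥0 → E)
    (s : ℝ) : ℝ :=
  (lam (f s.toNNReal) : ℝ) *
    Real.exp (-((kap (f s.toNNReal) : ℝ) * ∫ r in s..(t : ℝ), (mu (f r.toNNReal) : ℝ)))

/-- The time before `t` that two paths spend in different states. -/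
noncomputable def mismatch {E : Type*} (f g : ℝ≥0 → E) (t : ℝ≥0) : ℝ≥0∞ :=
  volume.restrict (Set.Ioc 0 (t : ℝ)) {s : ℝ | g s.toNNReal ≠ f s.toNNReal}

lemma abs_exp_neg_sub_exp_neg_le {x y : ℝ} (hx : 0 ≤ x) (hy : 0 ≤ y) :
    |Real.exp (-x) - Real.exp (-y)| ≤ |x - y| := by
  have hlip := (convex_Iic (0 : ℝ)).norm_image_sub_le_of_norm_deriv_le (f := Real.exp) (C := 1)
    (fun z _ => Real.differentiableAt_exp) (fun z hz => by simpa using hz)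
    (neg_nonpos.2 hx) (neg_nonpos.2 hy)
  rw [abs_sub_comm]
  simpa [Real.norm_eq_abs, neg_add_eq_sub] using hlip

lemma abs_intervalIntegral_sub_le {u v : ℝ → ℝ} {S : Set ℝ} {a b M K : ℝ} (hS : MeasurableSet S)
    (hab : a ≤ b) (hu : IntervalIntegrable u volume a b) (hv : IntervalIntegrable v volume a b)
    (h : ∀ s ∈ Set.Icc a b, |u s - v s| ≤ M * S.indicator 1 s + K) :
    |(∫ s in a..b, u s) - ∫ s in a..b, v s|
      ≤ M * (volume.restrict (Set.Ioc a b)).real S + K * (b - a) := by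
  have hind : IntervalIntegrable (S.indicator (1 : ℝ → ℝ)) volume a b :=
    (intervalIntegrable_iff_integrableOn_Ioc_of_le hab).2 ((integrable_const 1).indicator hS)
  have hval : ∫ s in a..b, S.indicator (1 : ℝ → ℝ) s = (volume.restrict (Set.Ioc a b)).real S := by
    rw [intervalIntegral.integral_of_le hab, integral_indicator_one hS]
  rw [← intervalIntegral.integral_sub hu hv]
  calc |∫ s in a..b, (u s - v s)| ≤ ∫ s in a..b, |u s - v s| :=
        intervalIntegral.abs_integral_le_integral_abs hab
    _ ≤ ∫ s in a..b, (M * S.indicator 1 s + K) :=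
        intervalIntegral.integral_mono_on hab (hu.sub hv).abs
          ((hind.const_mul M).add intervalIntegrable_const) h
    _ = _ := by
        rw [intervalIntegral.integral_add (hind.const_mul M) intervalIntegrable_const,
          intervalIntegral.integral_const_mul, hval, intervalIntegral.integral_const, smul_eq_mul,
          mul_comm K]

section Parameter

variable {E : Type*} (lam kap mu g : E → ℝ≥0) {M : ℝ≥0} (t : ℝ≥0) {f : ℝ≥0 → E} {s : ℝ}

lemma intervalIntegral_comp_path_nonneg (f : ℝ≥0 → E) {a b : ℝ} (hab : a ≤ b) :
    0 ≤ ∫ r in a..b, (g (f r.toNNReal) : ℝ) :=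
  intervalIntegral.integral_nonneg hab fun _ _ => NNReal.coe_nonneg _

lemma retainedRate_nonneg (f : ℝ≥0 → E) (s : ℝ) : 0 ≤ retainedRate lam kap mu t f s := by
  unfold retainedRate
  positivity

lemma retainedRate_le (hlam : ∀ x, lam x ≤ M) (f : ℝ≥0 → E) (hs : s ≤ t) :
    retainedRate lam kap mu t f s ≤ M :=
  (mul_le_of_le_one_right (NNReal.coe_nonneg _) (Real.exp_le_one_iff.2 (neg_nonpos.2
    (mul_nonneg (NNReal.coe_nonneg _) (intervalIntegral_comp_path_nonneg mu f hs))))).trans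
    (hlam _)

lemma phi_nonneg (f : ℝ≥0 → E) : 0 ≤ phi lam kap mu t f :=
  intervalIntegral.integral_nonneg t.coe_nonneg fun s _ => retainedRate_nonneg lam kap mu t f s

variable [Finite E] [MeasurableSpace E] [MeasurableSingletonClass E]

lemma measurable_comp_path (hf : Measurable f) :
    Measurable (fun s : ℝ => (g (f s.toNNReal) : ℝ)) :=
  ((measurable_of_finite g).comp (hf.comp measurable_real_toNNReal)).coe_nnreal_real

lemma intervalIntegrable_comp_path (hf : Measurable f) (a b : ℝ) :
    IntervalIntegrable (fun s : ℝ => (g (f s.toNNReal) : ℝ)) volume a b := by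
  obtain ⟨M, hM⟩ := Finite.exists_le g
  refine intervalIntegrable_iff.2 (Measure.integrableOn_of_bounded (M := M) (by simp)
    (measurable_comp_path g hf).aestronglyMeasurable (ae_of_all _ fun s => ?_))
  simpa using hM _

lemma continuous_integral_comp_path (hf : Measurable f) (a : ℝ) :
    Continuous (fun s => ∫ r in a..s, (g (f r.toNNReal) : ℝ)) :=
  intervalIntegral.continuous_primitive (intervalIntegrable_comp_path g hf) a

lemma measurable_retainedRate (hf : Measurable f) : Measurable (retainedRate lam kap mu t f) := by
  have hwork : Measurable fun s : ℝ => ∫ r in s..(t : ℝ), (mu (f r.toNNReal) : ℝ) := by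
    simp only [intervalIntegral.integral_symm (t : ℝ)]
    exact (continuous_integral_comp_path mu hf t).measurable.neg
  exact (measurable_comp_path lam hf).mul ((measurable_comp_path kap hf).mul hwork).neg.exp

lemma intervalIntegrable_retainedRate (hf : Measurable f) :
    IntervalIntegrable (retainedRate lam kap mu t f) volume 0 t := by
  obtain ⟨M, hM⟩ := Finite.exists_le lam
  rw [intervalIntegrable_iff_integrableOn_Ioc_of_le t.coe_nonneg]
  refine Measure.integrableOn_of_bounded (M := M) (by simp)
    (measurable_retainedRate lam kap mu t hf).aestronglyMeasurable ?_
  filter_upwards [ae_restrict_mem measurableSet_Ioc] with s hs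
  rw [Real.norm_of_nonneg (retainedRate_nonneg ..)]
  exact retainedRate_le lam kap mu t hM f hs.2

lemma phi_le (hlam : ∀ x, lam x ≤ M) (hf : Measurable f) : phi lam kap mu t f ≤ M * t := by
  have hmono := intervalIntegral.integral_mono_on t.coe_nonneg
    (intervalIntegrable_retainedRate lam kap mu t hf) (intervalIntegrable_const (c := (M : ℝ)))
    fun s hs => retainedRate_le lam kap mu t hlam f hs.2
  refine hmono.trans_eq ?_
  rw [intervalIntegral.integral_const, sub_zero, smul_eq_mul, mul_comm]

end Parameter

section CadlagProcess

lemma measurable_uncurry_comp_fst {E α β : Type*} [MeasurableSpace E] [MeasurableSpace α]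
    [MeasurableSpace β] {J : ℝ≥0 → α → E} (hJ : Measurable (Function.uncurry J)) :
    Measurable (Function.uncurry fun s (p : α × β) => J s p.1) :=
  hJ.comp (measurable_fst.prodMk measurable_snd.fst)

variable {E Ω : Type*} [MeasurableSpace Ω] [Finite E] [MeasurableSpace E]
  [MeasurableSingletonClass E] {J : ℝ≥0 → Ω → E}

lemma measurable_comp_process (hJ : Measurable (Function.uncurry J)) (g : E → ℝ≥0) :
    Measurable (fun p : Ω × ℝ => (g (J p.2.toNNReal p.1) : ℝ)) :=
  ((measurable_of_finite g).comp
    (hJ.comp (measurable_snd.real_toNNReal.prodMk measurable_fst))).coe_nnreal_real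

lemma measurable_integral_comp_process (hJ : Measurable (Function.uncurry J)) (g : E → ℝ≥0)
    {a b : Ω → ℝ} (ha : Measurable a) (hb : Measurable b) :
    Measurable (fun ω => ∫ r in (a ω)..(b ω), (g (J r.toNNReal ω) : ℝ)) :=
  (stronglyMeasurable_intervalIntegral (g := fun ω r => (g (J r.toNNReal ω) : ℝ))
    (measurable_comp_process hJ g).stronglyMeasurable ha hb).measurable

lemma measurable_phi (hJ : Measurable (Function.uncurry J)) (lam kap mu : E → ℝ≥0) (t : ℝ≥0) :
    Measurable (fun ω => phi lam kap mu t (fun s => J s ω)) := by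
  have hwork : Measurable fun p : Ω × ℝ => ∫ r in p.2..(t : ℝ), (mu (J r.toNNReal p.1) : ℝ) :=
    measurable_integral_comp_process (measurable_uncurry_comp_fst hJ) mu measurable_snd
      measurable_const
  exact (stronglyMeasurable_intervalIntegral
    (g := fun ω s => retainedRate lam kap mu t (fun r => J r ω) s)
    ((measurable_comp_process hJ lam).mul
      ((measurable_comp_process hJ kap).mul hwork).neg.exp).stronglyMeasurable
    measurable_const measurable_const).measurable

end CadlagProcess

section Lipschitz

variable {E : Type*} {lam kap mu : E → ℝ≥0} {M : ℝ≥0} {t : ℝ≥0} {f g : ℝ≥0 → E}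

lemma abs_sub_le_of_le {x y : ℝ≥0} (hx : x ≤ M) (hy : y ≤ M) : |(x : ℝ) - y| ≤ M := by
  have hx' : (x : ℝ) ≤ M := hx
  have hy' : (y : ℝ) ≤ M := hy
  exact abs_sub_le_of_nonneg_of_le x.coe_nonneg hx' y.coe_nonneg hy'

variable [Finite E] [MeasurableSpace E] [MeasurableSingletonClass E]

lemma measurableSet_mismatch (hf : Measurable f) (hg : Measurable g) :
    MeasurableSet {s : ℝ | g s.toNNReal ≠ f s.toNNReal} :=
  (measurableSet_eq_fun (hg.comp measurable_real_toNNReal)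
    (hf.comp measurable_real_toNNReal)).compl

lemma abs_integral_comp_path_sub_le (hmu : ∀ x, mu x ≤ M) (hf : Measurable f) (hg : Measurable g)
    {s : ℝ} (hs : s ∈ Set.Icc 0 (t : ℝ)) :
    |(∫ r in s..(t : ℝ), (mu (g r.toNNReal) : ℝ)) - ∫ r in s..(t : ℝ), (mu (f r.toNNReal) : ℝ)|
      ≤ M * (mismatch f g t).toReal := by
  refine (abs_intervalIntegral_sub_le (M := M) (K := 0) (measurableSet_mismatch hf hg) hs.2
    (intervalIntegrable_comp_path mu hg _ _) (intervalIntegrable_comp_path mu hf _ _)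
    fun r _ => ?_).trans ?_
  · by_cases h : g r.toNNReal = f r.toNNReal
    · simp [h]
    · simpa [h] using abs_sub_le_of_le (hmu _) (hmu _)
  · rw [zero_mul, add_zero]
    refine mul_le_mul_of_nonneg_left (ENNReal.toReal_mono (measure_ne_top _ _)
      (Measure.restrict_mono ?_ le_rfl _)) M.coe_nonneg
    exact Set.Ioc_subset_Ioc_left hs.1

lemma abs_retainedRate_sub_le (hlam : ∀ x, lam x ≤ M) (hkap : ∀ x, kap x ≤ M)
    (hmu : ∀ x, mu x ≤ M) (hf : Measurable f) (hg : Measurable g) {s : ℝ}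
    (hs : s ∈ Set.Icc 0 (t : ℝ)) (h : g s.toNNReal = f s.toNNReal) :
    |retainedRate lam kap mu t g s - retainedRate lam kap mu t f s|
      ≤ M ^ 3 * (mismatch f g t).toReal := by
  have hkap₀ : (0 : ℝ) ≤ kap (f s.toNNReal) := NNReal.coe_nonneg _
  have hexp := abs_exp_neg_sub_exp_neg_le
    (mul_nonneg hkap₀ (intervalIntegral_comp_path_nonneg mu g hs.2))
    (mul_nonneg hkap₀ (intervalIntegral_comp_path_nonneg mu f hs.2))
  rw [← mul_sub, abs_mul, abs_of_nonneg hkap₀] at hexp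
  rw [retainedRate, retainedRate, h, ← mul_sub, abs_mul, abs_of_nonneg (NNReal.coe_nonneg _)]
  calc _ ≤ (M : ℝ) * (M * (M * (mismatch f g t).toReal)) :=
        mul_le_mul (hlam _) (hexp.trans (mul_le_mul (hkap _)
          (abs_integral_comp_path_sub_le hmu hf hg hs) (abs_nonneg _) M.coe_nonneg))
          (abs_nonneg _) M.coe_nonneg
    _ = _ := by ring

theorem abs_phi_sub_phi_le (hlam : ∀ x, lam x ≤ M) (hkap : ∀ x, kap x ≤ M)
    (hmu : ∀ x, mu x ≤ M) (t : ℝ≥0) (hf : Measurable f) (hg : Measurable g) :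
    |phi lam kap mu t g - phi lam kap mu t f| ≤ (M + M ^ 3 * t) * (mismatch f g t).toReal := by
  refine (abs_intervalIntegral_sub_le (M := M) (K := M ^ 3 * (mismatch f g t).toReal)
    (measurableSet_mismatch hf hg) t.coe_nonneg (intervalIntegrable_retainedRate lam kap mu t hg)
    (intervalIntegrable_retainedRate lam kap mu t hf) fun s hs => ?_).trans_eq ?_
  · by_cases h : g s.toNNReal = f s.toNNReal
    · simpa [h] using abs_retainedRate_sub_le hlam hkap hmu hf hg hs h
    · have hle := abs_sub_le_of_nonneg_of_le (retainedRate_nonneg lam kap mu t g s)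
        (retainedRate_le lam kap mu t hlam g hs.2) (retainedRate_nonneg lam kap mu t f s)
        (retainedRate_le lam kap mu t hlam f hs.2)
      refine hle.trans ?_
      rw [Set.indicator_of_mem h, Pi.one_apply, mul_one]
      exact le_add_of_nonneg_right (by positivity)
  · rw [mismatch, ← measureReal_def]
    ring

end Lipschitz

/-! ### Transition probabilities of an irreducible chain -/

section Transition

variable {E : Type*} [Fintype E] [DecidableEq E]

attribute [local instance] Matrix.linftyOpNormedRing
attribute [local instance] Matrix.linftyOpNormedAlgebra

/-- The probability that a Markov chain with rate matrix `Q` moves from `x` to `y` within a period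
of length `h`. -/
noncomputable def transitionProb (Q : Matrix E E ℝ) (h : ℝ) (x y : E) : ℝ :=
  NormedSpace.exp (h • Q) x y

lemma transitionProb_zero_self (Q : Matrix E E ℝ) (x : E) : transitionProb Q 0 x x = 1 := by
  rw [transitionProb, zero_smul, NormedSpace.exp_zero, Matrix.one_apply_eq]

lemma continuous_transitionProb (Q : Matrix E E ℝ) (x y : E) :
    Continuous (fun h => transitionProb Q h x y) := by
  have hexp : Continuous (fun h : ℝ => NormedSpace.exp (h • Q)) :=
    NormedSpace.exp_continuous.comp (by fun_prop)
  exact (continuous_apply y).comp ((continuous_apply x).comp hexp)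

lemma exists_pow_apply_pos {B : Matrix E E ℝ} (hB : ∀ x y, 0 ≤ B x y) {x y : E}
    (h : Relation.ReflTransGen (fun u v => 0 < B u v) x y) : ∃ n, 0 < (B ^ n) x y := by
  induction h with
  | refl => exact ⟨0, by simp⟩
  | @tail z w _ hzw ih =>
    obtain ⟨n, hn⟩ := ih
    refine ⟨n + 1, ?_⟩
    rw [pow_succ, Matrix.mul_apply]
    exact Finset.sum_pos' (fun v _ => mul_nonneg (Matrix.pow_apply_nonneg hB n x v) (hB v w))
      ⟨z, Finset.mem_univ z, mul_pos hn hzw⟩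

lemma exp_apply_pos_of_reflTransGen {B : Matrix E E ℝ} (hB : ∀ x y, 0 ≤ B x y) {x y : E}
    (h : Relation.ReflTransGen (fun u v => 0 < B u v) x y) : 0 < NormedSpace.exp B x y := by
  obtain ⟨n, hn⟩ := exists_pow_apply_pos hB h
  have hsum : HasSum (fun n : ℕ => (n.factorial : ℝ)⁻¹ * (B ^ n) x y) (NormedSpace.exp B x y) :=
    Pi.hasSum.1 (Pi.hasSum.1 (NormedSpace.exp_series_hasSum_exp' (𝕂 := ℝ) B) x) y
  calc 0 < (n.factorial : ℝ)⁻¹ * (B ^ n) x y := by positivity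
    _ ≤ _ := le_hasSum hsum n fun k _ =>
      mul_nonneg (by positivity) (Matrix.pow_apply_nonneg hB k x y)

lemma exp_add_smul_one (B : Matrix E E ℝ) (c : ℝ) :
    NormedSpace.exp (B + c • (1 : Matrix E E ℝ)) = Real.exp c • NormedSpace.exp B := by
  have hscalar : NormedSpace.exp (c • (1 : Matrix E E ℝ)) = Real.exp c • 1 := by
    have halg := NormedSpace.algebraMap_exp_comm (𝕂 := ℝ) (𝔸 := Matrix E E ℝ) c
    rwa [Algebra.algebraMap_eq_smul_one, Algebra.algebraMap_eq_smul_one, ← Real.exp_eq_exp_ℝ,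
      eq_comm] at halg
  rw [Matrix.exp_add_of_commute _ _ ((Commute.one_right B).smul_right c), hscalar, mul_smul_comm,
    mul_one]

lemma transitionProb_pos {Q : Matrix E E ℝ} (hQ : IsRateMatrix Q)
    (hirr : IsIrreducibleRateMatrix Q) {h : ℝ} (hh : 0 < h) (x y : E) :
    0 < transitionProb Q h x y := by
  -- Adding a large multiple of the identity makes all entries nonnegative and only rescales `exp`.
  set c : ℝ := ∑ z, |Q z z|
  have hoff {u v : E} (huv : u ≠ v) : (h • Q + (h * c) • (1 : Matrix E E ℝ)) u v = h * Q u v := by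
    simp [Matrix.one_apply_ne huv]
  have hnonneg (u v : E) : 0 ≤ (h • Q + (h * c) • (1 : Matrix E E ℝ)) u v := by
    rcases eq_or_ne u v with rfl | huv
    · have hc : |Q u u| ≤ c := Finset.single_le_sum (f := fun z => |Q z z|)
        (fun z _ => abs_nonneg _) (Finset.mem_univ u)
      simpa [mul_add] using mul_nonneg hh.le (neg_le_iff_add_nonneg.1 ((abs_le.1 hc).1))
    · exact (mul_nonneg hh.le (hQ.nonneg u v huv)).trans_eq (hoff huv).symm
  have hpath : Relation.ReflTransGen
      (fun u v => 0 < (h • Q + (h * c) • (1 : Matrix E E ℝ)) u v) x y :=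
    Relation.ReflTransGen.mono (fun u v huv => (mul_pos hh huv.2).trans_eq (hoff huv.1).symm)
      x y (hirr x y)
  have hpos := exp_apply_pos_of_reflTransGen hnonneg hpath
  rw [exp_add_smul_one, Matrix.smul_apply, smul_eq_mul] at hpos
  exact pos_of_mul_pos_right hpos (Real.exp_pos _).le

end Transition

/-! ### Markov chains follow a given path with positive probability -/

/-- The sequence `s` with the value `a` inserted between its terms of indices `j` and `j + 1`. -/
def insertAfter {α : Type*} (s : ℕ → α) (j : ℕ) (a : α) (i : ℕ) : α :=
  if i ≤ j then s i else if i = j + 1 then a else s (i - 1)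

section InsertAfter

variable {α : Type*} (s : ℕ → α) (a : α) {i j : ℕ}

lemma insertAfter_of_le (hi : i ≤ j) : insertAfter s j a i = s i := if_pos hi

lemma insertAfter_succ_self : insertAfter s j a (j + 1) = a := by simp [insertAfter]

lemma insertAfter_succ_of_lt (hi : j < i) : insertAfter s j a (i + 1) = s i := by
  simp [insertAfter, show ¬ i + 1 ≤ j by omega, hi.ne']

variable {s a}

lemma monotone_insertAfter [Preorder α] (hs : Monotone s) (h₁ : s j ≤ a) (h₂ : a ≤ s (j + 1)) :
    Monotone (insertAfter s j a) := by
  refine monotone_nat_of_le_succ fun i => ?_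
  rcases lt_trichotomy i j with hi | rfl | hi
  · rw [insertAfter_of_le s a hi.le, insertAfter_of_le s a (Nat.succ_le_of_lt hi)]
    exact hs (Nat.le_succ i)
  · rwa [insertAfter_of_le s a le_rfl, insertAfter_succ_self]
  · rw [insertAfter_succ_of_lt s a hi]
    rcases (Nat.succ_le_of_lt hi).eq_or_lt with rfl | hi'
    · rwa [insertAfter_succ_self]
    · obtain ⟨k, rfl⟩ := Nat.exists_eq_add_one_of_ne_zero (Nat.ne_zero_of_lt hi)
      rw [insertAfter_succ_of_lt s a (Nat.succ_lt_succ_iff.1 hi')]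
      exact hs (Nat.le_succ k)

end InsertAfter

/-- The event that the process visits the states `x 0, …, x m` at the times `s 0, …, s m`. -/
def gridEvent {T Ω E : Type*} (J : T → Ω → E) (s : ℕ → T) (x : ℕ → E) (m : ℕ) : Set Ω :=
  {ω | ∀ i ≤ m, J (s i) ω = x i}

section GridEvent

variable {T Ω E : Type*} {J : T → Ω → E} (s : ℕ → T) (x : ℕ → E) (u : T) (y : E) {j m : ℕ}

lemma gridEvent_insertAfter_self :
    gridEvent J (insertAfter s j u) (insertAfter x j y) j = gridEvent J s x j := by
  ext ω
  refine forall₂_congr fun i hi => ?_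
  rw [insertAfter_of_le s u hi, insertAfter_of_le x y hi]

lemma gridEvent_insertAfter_succ (hjm : j < m) :
    gridEvent J (insertAfter s j u) (insertAfter x j y) (m + 1)
      = gridEvent J s x m ∩ {ω | J u ω = y} := by
  ext ω
  simp only [gridEvent, Set.mem_inter_iff, Set.mem_ofPred_eq]
  refine ⟨fun h => ⟨fun i hi => ?_, ?_⟩, fun ⟨h, hu⟩ i hi => ?_⟩
  · rcases le_or_gt i j with hij | hij
    · simpa only [insertAfter_of_le _ _ hij] using h i (by omega)
    · simpa only [insertAfter_succ_of_lt _ _ hij] using h (i + 1) (by omega)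
  · simpa only [insertAfter_succ_self] using h (j + 1) (by omega)
  · rcases lt_trichotomy i (j + 1) with hij | rfl | hij
    · simpa only [insertAfter_of_le _ _ (Nat.lt_succ_iff.1 hij)] using h i (by omega)
    · simpa only [insertAfter_succ_self] using hu
    · obtain ⟨k, rfl⟩ := Nat.exists_eq_add_one_of_ne_zero (Nat.ne_zero_of_lt hij)
      simpa only [insertAfter_succ_of_lt _ _ (Nat.succ_lt_succ_iff.1 hij)] using h k (by omega)

lemma measurableSet_gridEvent [MeasurableSpace Ω] [MeasurableSpace E] [MeasurableSingletonClass E]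
    (hJ : ∀ s, Measurable (J s)) (m : ℕ) : MeasurableSet (gridEvent J s x m) := by
  simp only [gridEvent, Set.ofPred_forall]
  exact .iInter fun i => .iInter fun _ => hJ (s i) (measurableSet_singleton (x i))

end GridEvent

section Markov

variable {E Ω : Type*} [Fintype E] [DecidableEq E] [MeasurableSpace Ω] {P : Measure Ω}
  {J : ℝ≥0 → Ω → E} {Q : Matrix E E ℝ} {s : ℕ → ℝ≥0}

lemma IsMarkovChainWithRates.real_gridEvent_succ (h : IsMarkovChainWithRates P J Q)
    (hs : Monotone s) (x : ℕ → E) (m : ℕ) :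
    P.real (gridEvent J s x (m + 1)) =
      P.real (gridEvent J s x m) * transitionProb Q (s (m + 1) - s m) (x m) (x (m + 1)) :=
  h m s x hs

lemma IsMarkovChainWithRates.real_gridEvent_inter (h : IsMarkovChainWithRates P J Q)
    (hs : Monotone s) (x : ℕ → E) {j m : ℕ} (hjm : j < m) {u : ℝ≥0} (hju : s j ≤ u)
    (huj : u ≤ s (j + 1)) (y : E) :
    P.real (gridEvent J s x m ∩ {ω | J u ω = y}) *
        transitionProb Q (s (j + 1) - s j) (x j) (x (j + 1)) =
      P.real (gridEvent J s x m) *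
        (transitionProb Q (u - s j) (x j) y * transitionProb Q (s (j + 1) - u) y (x (j + 1))) := by
  have hs' := monotone_insertAfter hs hju huj
  induction m, Nat.succ_le_of_lt hjm using Nat.le_induction with
  | base =>
    rw [← gridEvent_insertAfter_succ s x u y hjm, h.real_gridEvent_succ hs',
      h.real_gridEvent_succ hs', gridEvent_insertAfter_self, h.real_gridEvent_succ hs]
    simp only [Nat.succ_eq_add_one, insertAfter_succ_self, insertAfter_of_le _ _ le_rfl,
      insertAfter_succ_of_lt _ _ (Nat.lt_succ_self j)]
    ring
  | succ m hm ih =>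
    have hjm' : j < m := hm
    specialize ih hjm'
    rw [← gridEvent_insertAfter_succ s x u y hjm'] at ih
    rw [← gridEvent_insertAfter_succ s x u y hjm, h.real_gridEvent_succ hs',
      h.real_gridEvent_succ hs]
    simp only [insertAfter_succ_of_lt _ _ hjm, insertAfter_succ_of_lt _ _ hjm']
    linear_combination transitionProb Q (s (m + 1) - s m) (x m) (x (m + 1)) * ih

lemma IsMarkovChainWithRates.real_gridEvent_pos (h : IsMarkovChainWithRates P J Q)
    (hQ : IsRateMatrix Q) (hirr : IsIrreducibleRateMatrix Q) (hs : StrictMono s)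
    {x : ℕ → E} (h₀ : 0 < P.real {ω | J (s 0) ω = x 0}) (m : ℕ) :
    0 < P.real (gridEvent J s x m) := by
  induction m with
  | zero => simpa [gridEvent] using h₀
  | succ m ih =>
    rw [h.real_gridEvent_succ hs.monotone]
    exact mul_pos ih (transitionProb_pos hQ hirr
      (sub_pos.2 (NNReal.coe_lt_coe.2 (hs (Nat.lt_succ_self m)))) _ _)

lemma exists_measureReal_fiber_pos {ι : Type*} [Countable ι] [IsFiniteMeasure P] [NeZero P]
    (X : Ω → ι) : ∃ i, 0 < P.real {ω | X ω = i} := by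
  have hcover : ⋃ i, {ω | X ω = i} = Set.univ := Set.eq_univ_of_forall fun ω => by simp
  obtain ⟨i, hi⟩ := exists_measure_pos_of_not_measure_iUnion_null
    (hcover.symm ▸ (Measure.measure_univ_pos.2 (NeZero.ne P)).ne')
  exact ⟨i, ENNReal.toReal_pos hi.ne' (measure_ne_top _ _)⟩

lemma IsMarkovChainWithRates.real_cond_gridEvent [MeasurableSpace E] [MeasurableSingletonClass E]
    (h : IsMarkovChainWithRates P J Q) (hJ : ∀ s, Measurable (J s)) (hQ : IsRateMatrix Q)
    (hirr : IsIrreducibleRateMatrix Q) (hs : StrictMono s) {x : ℕ → E}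
    (h₀ : 0 < P.real {ω | J (s 0) ω = x 0}) {j m : ℕ} (hjm : j < m) {u : ℝ≥0} (hju : s j ≤ u)
    (huj : u ≤ s (j + 1)) (y : E) :
    P[|gridEvent J s x m].real {ω | J u ω = y} =
      transitionProb Q (u - s j) (x j) y * transitionProb Q (s (j + 1) - u) y (x (j + 1)) /
        transitionProb Q (s (j + 1) - s j) (x j) (x (j + 1)) := by
  have hgrid := h.real_gridEvent_pos hQ hirr hs h₀ m
  have htrans := transitionProb_pos hQ hirr
    (sub_pos.2 (NNReal.coe_lt_coe.2 (hs (Nat.lt_succ_self j)))) (x j) (x (j + 1))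
  have hcond : P[|gridEvent J s x m].real {ω | J u ω = y} =
      (P.real (gridEvent J s x m))⁻¹ * P.real (gridEvent J s x m ∩ {ω | J u ω = y}) := by
    simp only [measureReal_def, cond_apply (measurableSet_gridEvent s x hJ m), ENNReal.toReal_mul,
      ENNReal.toReal_inv]
  rw [hcond, eq_div_iff htrans.ne', mul_assoc, h.real_gridEvent_inter hs.monotone x hjm hju huj y,
    inv_mul_cancel_left₀ hgrid.ne']

end Markov

/-- The event that `J` starts in `y` and agrees with the path `f` at all later times up to `t` of
the grid of mesh `1 / (N + 1)`, including the first grid time after `t`. -/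
def shadowEvent {Ω E : Type*} (J : ℝ≥0 → Ω → E) (f : ℝ≥0 → E) (y : E) (t : ℝ≥0) (N : ℕ) : Set Ω :=
  gridEvent J (gridTime N) (Function.update (fun i => f (gridTime N i)) 0 y) (gridIndex N t + 1)

section Shadow

variable {E Ω : Type*} [Fintype E] [DecidableEq E] [MeasurableSpace Ω] {P : Measure Ω}
  {J : ℝ≥0 → Ω → E} {Q : Matrix E E ℝ} {f : ℝ≥0 → E} {y : E} {t v : ℝ≥0}

lemma IsMarkovChainWithRates.measure_shadowEvent_ne_zero (h : IsMarkovChainWithRates P J Q)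
    (hQ : IsRateMatrix Q) (hirr : IsIrreducibleRateMatrix Q) (hy : 0 < P.real {ω | J 0 ω = y})
    (f : ℝ≥0 → E) (t : ℝ≥0) (N : ℕ) : P (shadowEvent J f y t N) ≠ 0 := fun hzero =>
  (h.real_gridEvent_pos hQ hirr (strictMono_gridTime N)
    (by simpa [gridTime_zero] using hy) (gridIndex N t + 1)).ne'
    ((congrArg ENNReal.toReal hzero).trans ENNReal.toReal_zero)

variable [MeasurableSpace E] [MeasurableSingletonClass E]

lemma IsMarkovChainWithRates.eventually_real_cond_shadowEvent [TopologicalSpace E]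
    [DiscreteTopology E] (h : IsMarkovChainWithRates P J Q) (hJ : ∀ s, Measurable (J s))
    (hQ : IsRateMatrix Q) (hirr : IsIrreducibleRateMatrix Q) (hy : 0 < P.real {ω | J 0 ω = y})
    (hv₀ : 0 < v) (hvt : v ≤ t) (hcont : ContinuousAt f v) :
    ∀ᶠ N in atTop, P[|shadowEvent J f y t N].real {ω | J v ω = f v} =
      transitionProb Q (v - gridTime N (gridIndex N v)) (f v) (f v) *
        transitionProb Q (gridTime N (gridIndex N v + 1) - v) (f v) (f v) /
        transitionProb Q (1 / ((N : ℝ) + 1)) (f v) (f v) := by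
  have hconst : ∀ᶠ w in 𝓝 v, f w = f v := by
    rwa [ContinuousAt, nhds_discrete E, tendsto_pure] at hcont
  filter_upwards [(tendsto_gridTime_gridIndex v).eventually hconst,
    (tendsto_gridTime_gridIndex_succ v).eventually hconst,
    (tendsto_gridTime_gridIndex v).eventually (lt_mem_nhds hv₀)] with N hleft hright hpos
  have hindex : gridIndex N v ≠ 0 := fun hzero => by simp [hzero, gridTime_zero] at hpos
  rw [shadowEvent, h.real_cond_gridEvent hJ hQ hirr (strictMono_gridTime N)
    (by simpa [gridTime_zero] using hy) (Nat.lt_succ_of_le (monotone_gridIndex N hvt))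
    (gridTime_gridIndex_le N v) (le_gridTime_gridIndex_succ N v),
    Function.update_of_ne hindex, Function.update_of_ne (Nat.succ_ne_zero _), hleft, hright,
    coe_gridTime_succ_sub]

lemma IsMarkovChainWithRates.tendsto_cond_shadowEvent [IsFiniteMeasure P] [TopologicalSpace E]
    [DiscreteTopology E] (h : IsMarkovChainWithRates P J Q) (hJ : ∀ s, Measurable (J s))
    (hQ : IsRateMatrix Q) (hirr : IsIrreducibleRateMatrix Q) (hy : 0 < P.real {ω | J 0 ω = y})
    (hv₀ : 0 < v) (hvt : v ≤ t) (hcont : ContinuousAt f v) :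
    Tendsto (fun N => P[|shadowEvent J f y t N] {ω | J v ω ≠ f v}) atTop (𝓝 0) := by
  have htend {r : ℕ → ℝ} (hr : Tendsto r atTop (𝓝 0)) :
      Tendsto (fun N => transitionProb Q (r N) (f v) (f v)) atTop (𝓝 1) := by
    rw [← transitionProb_zero_self Q (f v)]
    exact ((continuous_transitionProb Q (f v) (f v)).tendsto 0).comp hr
  have hagree : Tendsto (fun N => P[|shadowEvent J f y t N].real {ω | J v ω = f v}) atTop
      (𝓝 (1 * 1 / 1)) :=
    (((htend (tendsto_sub_gridTime_gridIndex v)).mul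
      (htend (tendsto_gridTime_gridIndex_succ_sub v))).div
      (htend tendsto_one_div_add_atTop_nhds_zero_nat) one_ne_zero).congr'
      ((h.eventually_real_cond_shadowEvent hJ hQ hirr hy hv₀ hvt hcont).mono fun _ => Eq.symm)
  have hreal := ENNReal.tendsto_ofReal (hagree.const_sub 1)
  rw [mul_one, div_one, sub_self, ENNReal.ofReal_zero] at hreal
  refine hreal.congr fun N => ?_
  have := cond_isProbabilityMeasure (h.measure_shadowEvent_ne_zero hQ hirr hy f t N)
  have hcompl := probReal_compl_eq_one_sub (μ := P[|shadowEvent J f y t N])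
    (hJ v (measurableSet_singleton (f v)))
  exact (congrArg ENNReal.ofReal hcompl.symm).trans (ofReal_measureReal (measure_ne_top _ _))

end Shadow

section Comparison

lemma measure_slice_lt_pos {T Ω : Type*} [MeasurableSpace T] [MeasurableSpace Ω] {μ : Measure T}
    [IsFiniteMeasure μ] {P : Measure Ω} {Q : ℕ → Measure Ω} [∀ N, IsProbabilityMeasure (Q N)]
    (hQ : ∀ N, Q N ≪ P) {B : Set (T × Ω)} (hB : MeasurableSet B)
    (h : ∀ᵐ u ∂μ, Tendsto (fun N => Q N (Prod.mk u ⁻¹' B)) atTop (𝓝 0)) {δ : ℝ≥0∞} (hδ : δ ≠ 0) :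
    0 < P {ω | μ ((fun u => (u, ω)) ⁻¹' B) < δ} := by
  have hint : Tendsto (fun N => ∫⁻ u, Q N (Prod.mk u ⁻¹' B) ∂μ) atTop (𝓝 0) := by
    simpa using tendsto_lintegral_of_dominated_convergence (f := fun _ => 0) (fun _ => 1)
      (fun N => measurable_measure_prodMk_left (ν := Q N) hB)
      (fun N => Eventually.of_forall fun u => prob_le_one) (by simp) h
  by_contra hcon
  have hlarge : ∀ᵐ ω ∂P, δ ≤ μ ((fun u => (u, ω)) ⁻¹' B) := by
    simpa [ae_iff] using hcon
  have hle (N : ℕ) : δ ≤ ∫⁻ u, Q N (Prod.mk u ⁻¹' B) ∂μ :=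
    calc δ = ∫⁻ _, δ ∂(Q N) := by simp
      _ ≤ ∫⁻ ω, μ ((fun u => (u, ω)) ⁻¹' B) ∂(Q N) := lintegral_mono_ae ((hQ N).ae_le hlarge)
      _ = ∫⁻ u, Q N (Prod.mk u ⁻¹' B) ∂μ := by
        rw [← Measure.prod_apply_symm hB, Measure.prod_apply hB]
  exact hδ (nonpos_iff_eq_zero.1 (ge_of_tendsto' hint hle))

lemma IsCadlag.ae_continuousAt_toNNReal {E : Type*} [TopologicalSpace E] [DiscreteTopology E]
    {f : ℝ≥0 → E} (hf : IsCadlag f) :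
    ∀ᵐ u : ℝ, 0 ≤ u → ContinuousAt f u.toNNReal := by
  have hcountable := (countable_setOf_not_continuousAt_of_right fun t => (hf t).1).image
    ((↑) : ℝ≥0 → ℝ)
  filter_upwards [hcountable.ae_notMem volume] with u hu hu₀
  by_contra hcont
  exact hu ⟨u.toNNReal, hcont, Real.coe_toNNReal u hu₀⟩

lemma exists_mismatch_lt_imp_abs_phi_sub_phi_lt {E : Type*} [Finite E] [MeasurableSpace E]
    [MeasurableSingletonClass E] (lam kap mu : E → ℝ≥0) (t : ℝ≥0)
    {f : ℝ≥0 → E} (hf : Measurable f) {ε : ℝ} (hε : 0 < ε) :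
    ∃ δ : ℝ≥0∞, δ ≠ 0 ∧ ∀ g : ℝ≥0 → E, Measurable g → mismatch f g t < δ →
      |phi lam kap mu t g - phi lam kap mu t f| < ε := by
  obtain ⟨M, hM⟩ := Finite.exists_le fun x => lam x ⊔ kap x ⊔ mu x
  have hC : 0 < (M + M ^ 3 * t + 1 : ℝ) := by positivity
  refine ⟨ENNReal.ofReal (ε / (M + M ^ 3 * t + 1)), (ENNReal.ofReal_pos.2 (by positivity)).ne',
    fun g hg hlt => ?_⟩
  have hmismatch := (ENNReal.lt_ofReal_iff_toReal_lt hlt.ne_top).1 hlt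
  rw [lt_div_iff₀ hC] at hmismatch
  have hle := abs_phi_sub_phi_le (fun x => (le_sup_left.trans le_sup_left).trans (hM x))
    (fun x => (le_sup_right.trans le_sup_left).trans (hM x)) (fun x => le_sup_right.trans (hM x))
    t hf hg
  have := ENNReal.toReal_nonneg (a := mismatch f g t)
  linarith

variable {E Ω : Type*} [Fintype E] [DecidableEq E] [MetricSpace E] [MeasurableSpace E]
  [BorelSpace E] [MeasurableSpace Ω] {P : Measure Ω} [IsProbabilityMeasure P] {J : ℝ≥0 → Ω → E}

lemma IsIrreducibleMarkovChain.measure_mismatch_lt_pos (hM : IsIrreducibleMarkovChain P J)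
    (hJ : IsBackgroundProcess J) {f : ℝ≥0 → E} (hf : IsCadlag f) (t : ℝ≥0) {δ : ℝ≥0∞}
    (hδ : δ ≠ 0) : 0 < P {ω | mismatch f (fun s => J s ω) t < δ} := by
  obtain ⟨Q, hQ, hirr, h⟩ := hM
  obtain ⟨y, hy⟩ := exists_measureReal_fiber_pos (P := P) (J 0)
  have (N : ℕ) : IsProbabilityMeasure P[|shadowEvent J f y t N] :=
    cond_isProbabilityMeasure (h.measure_shadowEvent_ne_zero hQ hirr hy f t N)
  have hmeas : MeasurableSet {p : ℝ × Ω | J p.1.toNNReal p.2 ≠ f p.1.toNNReal} :=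
    (measurableSet_eq_fun
      (hJ.measurable_uncurry.comp (measurable_fst.real_toNNReal.prodMk measurable_snd))
      (hf.measurable.comp measurable_fst.real_toNNReal)).compl
  refine measure_slice_lt_pos (μ := volume.restrict (Set.Ioc 0 (t : ℝ)))
    (Q := fun N => P[|shadowEvent J f y t N]) (fun N => cond_absolutelyContinuous) hmeas ?_ hδ
  filter_upwards [ae_restrict_mem measurableSet_Ioc, ae_restrict_of_ae hf.ae_continuousAt_toNNReal]
    with u hu hcont
  simpa only [Set.preimage_ofPred_eq] using
    h.tendsto_cond_shadowEvent hJ.measurable hQ hirr hy (Real.toNNReal_pos.2 hu.1)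
      (Real.toNNReal_le_iff_le_coe.2 hu.2) (hcont hu.1.le)

lemma attainable_subset_of_isIrreducibleMarkovChain (hM : IsIrreducibleMarkovChain P J)
    (hJ : IsBackgroundProcess J) {Ω' : Type*} [MeasurableSpace Ω'] {P' : Measure Ω'}
    {J' : ℝ≥0 → Ω' → E} (hJ' : IsBackgroundProcess J') (lam kap mu : E → ℝ≥0) (t : ℝ≥0) :
    attainable (fun _ => paramLaw P' J' lam kap mu t) ⊆
      attainable (fun _ => paramLaw P J lam kap mu t) := by
  intro γ hγ ε hε
  refine ⟨0, fun n _ => ?_⟩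
  obtain ⟨N, hN⟩ := hγ (ε / 2) (half_pos hε)
  have hball := hN N le_rfl
  rw [paramLaw, Measure.map_apply (measurable_phi hJ'.measurable_uncurry lam kap mu t)
    measurableSet_ball] at hball
  obtain ⟨ω', hω'⟩ := nonempty_of_measure_ne_zero hball.ne'
  obtain ⟨δ, hδ, hclose⟩ := exists_mismatch_lt_imp_abs_phi_sub_phi_lt lam kap mu t
    (hJ'.cadlag ω').measurable (half_pos hε)
  rw [paramLaw, Measure.map_apply (measurable_phi hJ.measurable_uncurry lam kap mu t)
    measurableSet_ball]
  refine (hM.measure_mismatch_lt_pos hJ (hJ'.cadlag ω') t hδ).trans_le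
    (measure_mono fun ω hω => ?_)
  exact (dist_triangle _ _ _).trans_lt ((add_lt_add
    (hclose _ (hJ.cadlag ω).measurable hω) hω').trans_eq (add_halves ε))

end Comparison

/-! ### Hazard rates and the exponential distribution -/

section Hazard

variable {k : ℝ → ℝ} {K : ℝ}

lemma intervalIntegrable_of_measurable_bounded (hk : Measurable k) (hK : ∀ u, |k u| ≤ K)
    (a b : ℝ) : IntervalIntegrable k volume a b :=
  (intervalIntegrable_const (c := K)).mono_fun hk.aestronglyMeasurable <|
    .of_forall fun u => (hK u).trans (le_abs_self K)

lemma lipschitzWith_integral (hk : Measurable k) (hK : ∀ u, |k u| ≤ K) (a : ℝ) :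
    LipschitzWith K.toNNReal fun u => ∫ r in a..u, k r := by
  have hint := intervalIntegrable_of_measurable_bounded hk hK
  refine LipschitzWith.of_dist_le_mul fun x y => ?_
  rw [dist_eq_norm, intervalIntegral.integral_interval_sub_left (hint _ _) (hint _ _),
    Real.coe_toNNReal _ ((abs_nonneg _).trans (hK 0)), Real.dist_eq]
  exact intervalIntegral.norm_integral_le_of_norm_le_const fun u _ => hK u

lemma ae_hasDerivAt_exp_neg_integral (hk : Measurable k) (hK : ∀ u, |k u| ≤ K) (a : ℝ) :
    ∀ᵐ u, HasDerivAt (fun u => Real.exp (-∫ r in a..u, k r))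
      (-(k u * Real.exp (-∫ r in a..u, k r))) u := by
  have hloc : LocallyIntegrable k volume :=
    (locallyIntegrable_const K).mono hk.aestronglyMeasurable
      (.of_forall fun u => (hK u).trans (le_abs_self K))
  filter_upwards [_root_.LocallyIntegrable.ae_hasDerivAt_integral hloc] with u hu
  simpa [mul_comm] using (hu a).neg.exp

lemma integral_mul_exp_neg_integral (hk : Measurable k) (hK : ∀ u, |k u| ≤ K) (a b : ℝ) :
    ∫ u in a..b, k u * Real.exp (-∫ r in a..u, k r) = 1 - Real.exp (-∫ r in a..b, k r) := by
  have hlip : LocallyLipschitz fun u => Real.exp (-∫ r in a..u, k r) :=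
    (Real.contDiff_exp (n := 1)).locallyLipschitz.comp
      (lipschitzWith_integral hk hK a).neg.locallyLipschitz
  obtain ⟨C, hC⟩ := (hlip.locallyLipschitzOn (s := Set.uIcc a b)).exists_lipschitzOnWith_of_compact
    isCompact_uIcc
  have hftc := hC.absolutelyContinuousOnInterval.integral_deriv_eq_sub
  have hderiv : ∫ u in a..b, deriv (fun u => Real.exp (-∫ r in a..u, k r)) u
      = ∫ u in a..b, -(k u * Real.exp (-∫ r in a..u, k r)) := by
    refine intervalIntegral.integral_congr_ae ?_
    filter_upwards [ae_hasDerivAt_exp_neg_integral hk hK a] with u hu _ using hu.deriv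
  rw [hderiv, intervalIntegral.integral_neg, intervalIntegral.integral_same, neg_zero,
    Real.exp_zero] at hftc
  linarith

theorem lintegral_hazard_density (hk : Measurable k) (hk₀ : ∀ u, 0 ≤ k u) (hK : ∀ u, k u ≤ K)
    (htop : Tendsto (fun T => ∫ r in (0 : ℝ)..T, k r) atTop atTop) :
    ∫⁻ u in Set.Ioi 0, ENNReal.ofReal (k u * Real.exp (-∫ r in (0 : ℝ)..u, k r)) = 1 := by
  have habs : ∀ u, |k u| ≤ K := fun u => (abs_of_nonneg (hk₀ u)).trans_le (hK u)
  have hlim : Tendsto (fun T => ∫ u in (0 : ℝ)..T, k u * Real.exp (-∫ r in (0 : ℝ)..u, k r))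
      atTop (𝓝 1) := by
    simp only [integral_mul_exp_neg_integral hk habs]
    simpa using (Real.tendsto_exp_neg_atTop_nhds_zero.comp htop).const_sub 1
  have hnonneg : ∀ u, 0 ≤ k u * Real.exp (-∫ r in (0 : ℝ)..u, k r) := fun u =>
    mul_nonneg (hk₀ u) (Real.exp_nonneg _)
  have hint : IntegrableOn (fun u => k u * Real.exp (-∫ r in (0 : ℝ)..u, k r)) (Set.Ioi 0) := by
    refine integrableOn_Ioi_of_intervalIntegral_norm_tendsto 1 0 (fun T => ?_) tendsto_id
      (by simpa only [id, Real.norm_of_nonneg (hnonneg _)] using hlim)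
    exact ((intervalIntegrable_of_measurable_bounded hk habs 0 T).mul_continuousOn
      (lipschitzWith_integral hk habs 0).continuous.neg.rexp.continuousOn).1
  rw [← ofReal_integral_eq_lintegral_ofReal hint (.of_forall hnonneg),
    tendsto_nhds_unique (intervalIntegral_tendsto_integral_Ioi 0 hint tendsto_id) hlim,
    ENNReal.ofReal_one]

lemma lintegral_expMeasure_one {φ : ℝ → ℝ≥0∞} (hφ : Measurable φ) :
    ∫⁻ y, φ y ∂(expMeasure 1) = ∫⁻ y in Set.Ioi 0, ENNReal.ofReal (Real.exp (-y)) * φ y := by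
  have hpdf : Measurable (exponentialPDF 1) := (measurable_exponentialPDFReal 1).ennreal_ofReal
  rw [show expMeasure 1 = volume.withDensity (exponentialPDF 1) from rfl,
    lintegral_withDensity_eq_lintegral_mul _ hpdf hφ, ← lintegral_indicator measurableSet_Ioi]
  refine lintegral_congr_ae ?_
  filter_upwards [Measure.ae_ne volume (0 : ℝ)] with y hy
  rcases lt_or_gt_of_ne hy with h | h
  · simp [exponentialPDF_of_neg h, Set.indicator, h.not_gt]
  · simp [exponentialPDF_of_nonneg h.le, Set.indicator, h]

end Hazard

section Tail

variable {h : ℝ → ℝ} {L c : ℝ}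

lemma intervalIntegrable_of_mem_Icc (hh : Measurable h) (h01 : ∀ u, h u ∈ Set.Icc (0 : ℝ) 1)
    (a b : ℝ) : IntervalIntegrable h volume a b :=
  intervalIntegrable_of_measurable_bounded hh
    (fun u => (abs_of_nonneg (h01 u).1).trans_le (h01 u).2) a b

lemma integral_eq_zero_of_forall_gt (hL : ∀ u, L < u → h u = 0) {v : ℝ} (hv : L ≤ v) :
    ∫ r in v..L, h r = 0 := by
  rw [intervalIntegral.integral_symm, intervalIntegral.integral_of_le hv, neg_eq_zero]
  exact setIntegral_eq_zero_of_forall_eq_zero fun r hr => hL r hr.1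

lemma integral_mem_Icc_of_forall_gt (hh : Measurable h) (h01 : ∀ u, h u ∈ Set.Icc (0 : ℝ) 1)
    (hL : ∀ u, L < u → h u = 0) (hL₀ : 0 ≤ L) {v : ℝ} (hv : 0 ≤ v) :
    ∫ r in v..L, h r ∈ Set.Icc (0 : ℝ) (∫ r in (0 : ℝ)..L, h r) := by
  rcases le_total v L with hvL | hvL
  · refine ⟨intervalIntegral.integral_nonneg hvL fun r _ => (h01 r).1, ?_⟩
    exact intervalIntegral.integral_mono_interval hv hvL le_rfl (.of_forall fun r => (h01 r).1)
      (intervalIntegrable_of_mem_Icc hh h01 _ _)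
  · rw [integral_eq_zero_of_forall_gt hL hvL]
    exact ⟨le_rfl, intervalIntegral.integral_nonneg hL₀ fun r _ => (h01 r).1⟩

lemma measurable_integral_left (hh : Measurable h) (h01 : ∀ u, h u ∈ Set.Icc (0 : ℝ) 1) (L : ℝ) :
    Measurable fun u => ∫ r in u..L, h r := by
  simp only [intervalIntegral.integral_symm L]
  exact (intervalIntegral.continuous_primitive
    (intervalIntegrable_of_mem_Icc hh h01) L).measurable.neg

lemma integral_one_add_const_mul_comp_add_left (hh : Measurable h)
    (h01 : ∀ u, h u ∈ Set.Icc (0 : ℝ) 1) (c x L T : ℝ) :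
    ∫ y in (0 : ℝ)..T, (1 + c * h (x + y))
      = T + c * ((∫ r in x..L, h r) - ∫ r in (x + T)..L, h r) := by
  have hint := intervalIntegrable_of_mem_Icc hh h01
  have hint' : IntervalIntegrable (fun y => h (x + y)) volume 0 T :=
    intervalIntegrable_of_mem_Icc (hh.comp (measurable_const_add x)) (fun y => h01 (x + y)) 0 T
  rw [intervalIntegral.integral_add intervalIntegrable_const (hint'.const_mul c),
    intervalIntegral.integral_const_mul, intervalIntegral.integral_comp_add_left,
    ← intervalIntegral.integral_add_adjacent_intervals (hint x (x + T)) (hint (x + T) L)]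
  simp

/-- With `k y = 1 + c h (x + y)`, the integrand against the exponential density is the constant
`exp (c ∫ₓᴸ h)` times the density with hazard rate `k`. -/
theorem lintegral_expMeasure_mul_exp_integral (hh : Measurable h)
    (h01 : ∀ u, h u ∈ Set.Icc (0 : ℝ) 1) (hL : ∀ u, L < u → h u = 0) (hc : -1 ≤ c) (x : ℝ) :
    ∫⁻ y, ENNReal.ofReal (1 + c * h (x + y)) *
        ENNReal.ofReal (Real.exp (c * ∫ r in (x + y)..L, h r)) ∂(expMeasure 1)
      = ENNReal.ofReal (Real.exp (c * ∫ r in x..L, h r)) := by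
  have hk : Measurable fun y => 1 + c * h (x + y) := by fun_prop
  have hk₀ : ∀ y, 0 ≤ 1 + c * h (x + y) := fun y => by
    nlinarith [(h01 (x + y)).1, (h01 (x + y)).2]
  have hk_le : ∀ y, 1 + c * h (x + y) ≤ 1 + |c| := fun y => by
    nlinarith [(h01 (x + y)).1, (h01 (x + y)).2, le_abs_self c, abs_nonneg c]
  have hprim := integral_one_add_const_mul_comp_add_left hh h01 c x L
  have htop : Tendsto (fun T => ∫ y in (0 : ℝ)..T, (1 + c * h (x + y))) atTop atTop := by
    refine (tendsto_atTop_add_const_right _ (c * ∫ r in x..L, h r) tendsto_id).congr' ?_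
    filter_upwards [eventually_ge_atTop (L - x)] with T hT
    rw [hprim, integral_eq_zero_of_forall_gt hL (v := x + T) (by linarith), sub_zero, id]
  have hdensity : ∀ y, ENNReal.ofReal (Real.exp (-y)) * (ENNReal.ofReal (1 + c * h (x + y)) *
        ENNReal.ofReal (Real.exp (c * ∫ r in (x + y)..L, h r)))
      = ENNReal.ofReal (Real.exp (c * ∫ r in x..L, h r)) * ENNReal.ofReal
        ((1 + c * h (x + y)) * Real.exp (-∫ r in (0 : ℝ)..y, (1 + c * h (x + r)))) := fun y => by
    rw [← ENNReal.ofReal_mul (hk₀ y), ← ENNReal.ofReal_mul (Real.exp_nonneg _),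
      ← ENNReal.ofReal_mul (Real.exp_nonneg _), mul_left_comm, mul_left_comm (Real.exp _),
      ← Real.exp_add, ← Real.exp_add, hprim]
    ring_nf
  rw [lintegral_expMeasure_one]
  · simp only [hdensity]
    rw [lintegral_const_mul' _ _ ENNReal.ofReal_ne_top, lintegral_hazard_density hk hk₀ hk_le htop,
      mul_one]
  · exact hk.ennreal_ofReal.mul (((measurable_integral_left hh h01 L).comp
      (measurable_const_add x)).const_mul c).exp.ennreal_ofReal

end Tail

/-! ### Thinning of a marked Poisson process -/

/-- The interarrival times `e` and the marks `z` of a standard Poisson process with independent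
standard exponential marks. -/
structure IsMarkedPoisson {Ω : Type*} [MeasurableSpace Ω] (P : Measure Ω) (e z : ℕ → Ω → ℝ) :
    Prop where
  measurable_e : ∀ k, Measurable (e k)
  measurable_z : ∀ k, Measurable (z k)
  map_e : ∀ k, P.map (e k) = expMeasure 1
  map_z : ∀ k, P.map (z k) = expMeasure 1
  iIndep : iIndepFun (Sum.elim e z) P

/-- The probability that a point at time `u` is retained, when a point with mark `ζ` is retained
if and only if `(u, ζ) ∈ R`. -/
noncomputable def retention (R : Set (ℝ × ℝ)) (u : ℝ) : ℝ := (expMeasure 1).real {ζ | (u, ζ) ∈ R}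

/-- The number of points of the Poisson process with interarrival times `e` and marks `z` that are
retained. -/
noncomputable def numRetained (R : Set (ℝ × ℝ)) (e z : ℕ → ℝ) : ℝ≥0∞ :=
  ∑' k : ℕ, R.indicator (fun _ => (1 : ℝ≥0∞)) (poissonJumpTime e k, z k)

/-- The contribution `exp θ` of a retained point, and `1` of any other one, to the exponential
moment of order `θ` of the number of retained points. -/
noncomputable def markWeight (R : Set (ℝ × ℝ)) (θ : ℝ) (p : ℝ × ℝ) : ℝ≥0∞ :=
  ENNReal.ofReal (Real.exp (R.indicator (fun _ => θ) p))

/-- The exponential moment of order `θ` of the number of points retained between the times `x` and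
`L`. -/
noncomputable def tailFactor (R : Set (ℝ × ℝ)) (L θ x : ℝ) : ℝ≥0∞ :=
  ENNReal.ofReal (Real.exp ((Real.exp θ - 1) * ∫ r in x..L, retention R r))

/-- The conditional exponential moment of the number of retained points given the first `K` points,
a martingale in `K`. -/
noncomputable def momentMartingale (R : Set (ℝ × ℝ)) (L θ : ℝ) (e z : ℕ → ℝ) (K : ℕ) : ℝ≥0∞ :=
  (∏ k ∈ Finset.range K, markWeight R θ (poissonJumpTime e k, z k)) *
    tailFactor R L θ (∑ i ∈ Finset.range K, e i)

/-- The σ-algebra generated by the first `K` interarrival times and marks. -/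
abbrev pastAlgebra {Ω : Type*} (e z : ℕ → Ω → ℝ) (K : ℕ) : MeasurableSpace Ω :=
  ⨆ i ∈ {i : ℕ ⊕ ℕ | Sum.elim id id i < K}, MeasurableSpace.comap (Sum.elim e z i) inferInstance

section Retention

variable {R : Set (ℝ × ℝ)} {L θ x : ℝ}

instance : IsProbabilityMeasure (expMeasure 1) := isProbabilityMeasure_expMeasure one_pos

lemma measurable_retention (hR : MeasurableSet R) : Measurable (retention R) :=
  (measurable_measure_prodMk_left hR).ennreal_toReal

lemma retention_mem_Icc (u : ℝ) : retention R u ∈ Set.Icc (0 : ℝ) 1 :=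
  ⟨measureReal_nonneg, measureReal_le_one⟩

lemma retention_eq_zero (hL : ∀ p ∈ R, p.1 ≤ L) {u : ℝ} (hu : L < u) : retention R u = 0 := by
  have hempty : {ζ | (u, ζ) ∈ R} = ∅ :=
    Set.eq_empty_of_forall_notMem fun ζ hζ => (hL _ hζ).not_gt hu
  rw [retention, hempty, measureReal_empty]

lemma measurable_markWeight (hR : MeasurableSet R) : Measurable (markWeight R θ) :=
  (measurable_const.indicator hR).exp.ennreal_ofReal

lemma lintegral_markWeight (hR : MeasurableSet R) (u : ℝ) :
    ∫⁻ ζ, markWeight R θ (u, ζ) ∂(expMeasure 1)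
      = ENNReal.ofReal (1 + (Real.exp θ - 1) * retention R u) := by
  have hS : MeasurableSet {ζ | (u, ζ) ∈ R} := measurable_prodMk_left hR
  have hsplit : ∀ ζ, markWeight R θ (u, ζ) =
      {ζ | (u, ζ) ∈ R}.indicator (fun _ => ENNReal.ofReal (Real.exp θ)) ζ +
      {ζ | (u, ζ) ∈ R}ᶜ.indicator (fun _ => 1) ζ := by
    intro ζ
    by_cases h : (u, ζ) ∈ R <;> simp [markWeight, h]
  simp only [hsplit]
  rw [lintegral_add_left (measurable_const.indicator hS), lintegral_indicator_const hS,
    lintegral_indicator_const hS.compl, one_mul, ← ofReal_measureReal, ← ofReal_measureReal,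
    probReal_compl_eq_one_sub hS, ← ENNReal.ofReal_mul (Real.exp_nonneg _),
    ← ENNReal.ofReal_add (mul_nonneg (Real.exp_nonneg _) measureReal_nonneg)
      (sub_nonneg.2 measureReal_le_one), retention]
  ring_nf

lemma measurable_tailFactor (hR : MeasurableSet R) : Measurable (tailFactor R L θ) :=
  ((measurable_integral_left (measurable_retention hR) retention_mem_Icc L).const_mul
    _).exp.ennreal_ofReal

lemma tailFactor_eq_one (hL : ∀ p ∈ R, p.1 ≤ L) (hx : L ≤ x) : tailFactor R L θ x = 1 := by
  rw [tailFactor, integral_eq_zero_of_forall_gt (fun u hu => retention_eq_zero hL hu) hx]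
  simp

lemma tailFactor_le (hR : MeasurableSet R) (hL : ∀ p ∈ R, p.1 ≤ L) (hL₀ : 0 ≤ L) (hx : 0 ≤ x) :
    tailFactor R L θ x ≤
      ENNReal.ofReal (Real.exp (|Real.exp θ - 1| * ∫ r in (0 : ℝ)..L, retention R r)) := by
  have hmem := integral_mem_Icc_of_forall_gt (measurable_retention hR) retention_mem_Icc
    (fun u hu => retention_eq_zero hL hu) hL₀ hx
  exact ENNReal.ofReal_le_ofReal (Real.exp_le_exp.2
    (mul_le_mul (le_abs_self _) hmem.2 hmem.1 (abs_nonneg _)))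

lemma measurable_markWeight_mul_tailFactor (hR : MeasurableSet R) :
    Measurable fun q : ℝ × ℝ × ℝ =>
      markWeight R θ (q.1 + q.2.1, q.2.2) * tailFactor R L θ (q.1 + q.2.1) := by
  have hadd : Measurable fun q : ℝ × ℝ × ℝ => q.1 + q.2.1 := by fun_prop
  exact ((measurable_markWeight hR).comp (hadd.prodMk (by fun_prop))).mul
    ((measurable_tailFactor hR).comp hadd)

lemma lintegral_markWeight_mul_tailFactor (hR : MeasurableSet R) (hL : ∀ p ∈ R, p.1 ≤ L) (x : ℝ) :
    ∫⁻ p : ℝ × ℝ, markWeight R θ (x + p.1, p.2) * tailFactor R L θ (x + p.1)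
      ∂((expMeasure 1).prod (expMeasure 1)) = tailFactor R L θ x := by
  have hmeas := (measurable_markWeight_mul_tailFactor (L := L) (θ := θ) hR).comp
    (measurable_prodMk_left (x := x))
  have hmark : ∀ y, ∫⁻ ζ, markWeight R θ (x + y, ζ) * tailFactor R L θ (x + y) ∂(expMeasure 1)
      = ENNReal.ofReal (1 + (Real.exp θ - 1) * retention R (x + y)) *
        tailFactor R L θ (x + y) := fun y => by
    rw [lintegral_mul_const' (tailFactor R L θ (x + y)) _ ENNReal.ofReal_ne_top,
      lintegral_markWeight hR]
  refine (lintegral_prod _ hmeas.aemeasurable).trans ?_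
  simp only [Function.comp_def, hmark]
  exact lintegral_expMeasure_mul_exp_integral (measurable_retention hR) retention_mem_Icc
    (fun u hu => retention_eq_zero hL hu) (by linarith [Real.exp_pos θ]) x

lemma prod_markWeight_eq (e z : ℕ → ℝ) (K : ℕ) :
    ∏ k ∈ Finset.range K, markWeight R θ (poissonJumpTime e k, z k) =
      ENNReal.ofReal (Real.exp (θ * (∑ k ∈ Finset.range K,
        R.indicator (fun _ => (1 : ℝ≥0∞)) (poissonJumpTime e k, z k)).toReal)) := by
  rw [ENNReal.toReal_sum, Finset.mul_sum, Real.exp_sum,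
    ENNReal.ofReal_prod_of_nonneg fun _ _ => Real.exp_nonneg _]
  · refine Finset.prod_congr rfl fun k _ => ?_
    by_cases h : (poissonJumpTime e k, z k) ∈ R <;> simp [markWeight, h]
  · intro k _
    by_cases h : (poissonJumpTime e k, z k) ∈ R <;> simp [h]

lemma exists_forall_numRetained_eq_sum (hL : ∀ p ∈ R, p.1 ≤ L) {e z : ℕ → ℝ} (he : ∀ k, 0 ≤ e k)
    (hgt : ∃ k, L < e k) : ∃ K₀, ∀ K ≥ K₀, L < ∑ i ∈ Finset.range K, e i ∧
      numRetained R e z =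
        ∑ k ∈ Finset.range K, R.indicator (fun _ => (1 : ℝ≥0∞)) (poissonJumpTime e k, z k) := by
  obtain ⟨k₀, hk₀⟩ := hgt
  have hsum : ∀ K ≥ k₀ + 1, L < ∑ i ∈ Finset.range K, e i := fun K hK =>
    hk₀.trans_le (Finset.single_le_sum (fun i _ => he i) (Finset.mem_range.2 hK))
  refine ⟨k₀ + 1, fun K hK => ⟨hsum K hK, ?_⟩⟩
  refine tsum_eq_sum fun k hk => Set.indicator_of_notMem (fun hmem => ?_) _
  exact (hL _ hmem).not_gt (hsum (k + 1) (by have := Finset.mem_range.not.1 hk; lia))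

lemma prod_markWeight_le (hL : ∀ p ∈ R, p.1 ≤ L) {e z : ℕ → ℝ} (he : ∀ k, 0 ≤ e k)
    (hgt : ∃ k, L < e k) (K : ℕ) :
    ∏ k ∈ Finset.range K, markWeight R θ (poissonJumpTime e k, z k)
      ≤ 1 + ENNReal.ofReal (Real.exp (θ * (numRetained R e z).toReal)) := by
  obtain ⟨K₀, hK₀⟩ := exists_forall_numRetained_eq_sum (z := z) hL he hgt
  have hfin : numRetained R e z ≠ ⊤ := by
    rw [(hK₀ K₀ le_rfl).2]
    refine ENNReal.sum_ne_top.2 fun k _ => ?_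
    by_cases hk : (poissonJumpTime e k, z k) ∈ R <;> simp [hk]
  rw [prod_markWeight_eq]
  rcases le_total θ 0 with hθ | hθ
  · exact le_add_right (ENNReal.ofReal_le_one.2 (Real.exp_le_one_iff.2
      (mul_nonpos_of_nonpos_of_nonneg hθ ENNReal.toReal_nonneg)))
  · refine le_add_left ?_
    gcongr
    exact ENNReal.sum_le_tsum _

end Retention

namespace IsMarkedPoisson

variable {Ω : Type*} [MeasurableSpace Ω] {P : Measure Ω} {e z : ℕ → Ω → ℝ}
  {R : Set (ℝ × ℝ)} {L θ : ℝ}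

lemma indepFun_of_measurable_pastAlgebra (h : IsMarkedPoisson P e z) {β : Type*}
    [MeasurableSpace β] {U : Ω → β} {K : ℕ} (hU : Measurable[pastAlgebra e z K] U) :
    IndepFun U (fun ω => (e K ω, z K ω)) P := by
  have hle : ∀ i : ℕ ⊕ ℕ,
      MeasurableSpace.comap (Sum.elim e z i) inferInstance ≤ ‹MeasurableSpace Ω› := by
    rintro (i | i)
    exacts [(h.measurable_e i).comap_le, (h.measurable_z i).comap_le]
  have hind := indep_iSup_of_disjoint (S := {i : ℕ ⊕ ℕ | Sum.elim id id i < K})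
    (T := {i : ℕ ⊕ ℕ | Sum.elim id id i = K}) hle h.iIndep
    (Set.disjoint_left.2 fun i (hi : _ < K) (hi' : _ = K) => hi.ne hi')
  rw [IndepFun_iff_Indep]
  refine indep_of_indep_of_le_left (indep_of_indep_of_le_right hind ?_) hU.comap_le
  have hmeas : ∀ i : ℕ ⊕ ℕ, Sum.elim id id i = K →
      Measurable[⨆ i ∈ {i : ℕ ⊕ ℕ | Sum.elim id id i = K},
        MeasurableSpace.comap (Sum.elim e z i) inferInstance] (Sum.elim e z i) := fun i hi =>
    measurable_iff_comap_le.2 (le_iSup₂_of_le i hi le_rfl)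
  exact ((hmeas (Sum.inl K) rfl).prodMk (hmeas (Sum.inr K) rfl)).comap_le

lemma ae_pos (h : IsMarkedPoisson P e z) : ∀ᵐ ω ∂P, ∀ k, 0 < e k ω ∧ 0 < z k ω := by
  have hpos : ∀ᵐ x ∂(expMeasure 1), 0 < x := by
    rw [ae_iff]
    simp only [not_lt]
    change volume.withDensity (exponentialPDF 1) (Set.Iic 0) = 0
    rw [withDensity_apply _ measurableSet_Iic, Measure.restrict_congr_set Iio_ae_eq_Iic.symm]
    exact lintegral_exponentialPDF_of_nonpos le_rfl
  refine ae_all_iff.2 fun k => ?_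
  filter_upwards [ae_of_ae_map (h.measurable_e k).aemeasurable ((h.map_e k).symm ▸ hpos),
    ae_of_ae_map (h.measurable_z k).aemeasurable ((h.map_z k).symm ▸ hpos)] with ω he hz
  exact ⟨he, hz⟩

lemma measure_forall_le_eq_zero (h : IsMarkedPoisson P e z) {l : ℝ} (hl : 0 ≤ l) :
    P {ω | ∀ k, e k ω ≤ l} = 0 := by
  have hlt : expMeasure 1 (Set.Iic l) < 1 := by
    have hcdf := cdf_expMeasure_eq one_pos l
    rw [cdf_eq_real, if_pos hl, one_mul] at hcdf
    rw [← ofReal_measureReal, hcdf, ENNReal.ofReal_lt_one]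
    linarith [Real.exp_pos (-l)]
  have hbound : ∀ K : ℕ, P {ω | ∀ k, e k ω ≤ l} ≤ expMeasure 1 (Set.Iic l) ^ K := by
    intro K
    have hindep : iIndepFun e P := h.iIndep.precomp (g := Sum.inl) Sum.inl_injective
    have hprod := hindep.measure_inter_preimage_eq_mul (Finset.range K)
      (sets := fun _ => Set.Iic l) fun i _ => measurableSet_Iic
    simp only [← Measure.map_apply (h.measurable_e _) measurableSet_Iic, h.map_e,
      Finset.prod_const, Finset.card_range] at hprod
    rw [← hprod]
    exact measure_mono fun ω hω => Set.mem_iInter₂.2 fun i _ => hω i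
  exact le_antisymm (ge_of_tendsto' (ENNReal.tendsto_pow_atTop_nhds_zero_of_lt_one hlt) hbound)
    bot_le

lemma ae_exists_gt (h : IsMarkedPoisson P e z) {l : ℝ} (hl : 0 ≤ l) : ∀ᵐ ω ∂P, ∃ k, l < e k ω := by
  simpa [ae_iff] using h.measure_forall_le_eq_zero hl

lemma measurable_numRetained (h : IsMarkedPoisson P e z) (hR : MeasurableSet R) :
    Measurable fun ω => numRetained R (e · ω) (z · ω) :=
  Measurable.tsum fun k => (measurable_const.indicator hR).comp
    ((Finset.measurable_fun_sum _ fun i _ => h.measurable_e i).prodMk (h.measurable_z k))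

lemma measurable_momentMartingale (h : IsMarkedPoisson P e z) (hR : MeasurableSet R) (K : ℕ) :
    Measurable fun ω => momentMartingale R L θ (e · ω) (z · ω) K :=
  (Finset.measurable_fun_prod _ fun k _ => (measurable_markWeight hR).comp
    ((Finset.measurable_fun_sum _ fun i _ => h.measurable_e i).prodMk (h.measurable_z k))).mul
    ((measurable_tailFactor hR).comp (Finset.measurable_fun_sum _ fun i _ => h.measurable_e i))

lemma ae_tendsto_momentMartingale (h : IsMarkedPoisson P e z) (hL : ∀ p ∈ R, p.1 ≤ L)
    (hL₀ : 0 ≤ L) :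
    ∀ᵐ ω ∂P, Tendsto (fun K => momentMartingale R L θ (e · ω) (z · ω) K) atTop
      (𝓝 (ENNReal.ofReal (Real.exp (θ * (numRetained R (e · ω) (z · ω)).toReal)))) := by
  filter_upwards [h.ae_pos, h.ae_exists_gt hL₀] with ω hpos hgt
  obtain ⟨K₀, hK₀⟩ := exists_forall_numRetained_eq_sum (z := (z · ω)) hL
    (fun k => (hpos k).1.le) hgt
  refine tendsto_const_nhds.congr' ?_
  filter_upwards [eventually_ge_atTop K₀] with K hK
  rw [momentMartingale, tailFactor_eq_one hL (hK₀ K hK).1.le, mul_one, prod_markWeight_eq,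
    (hK₀ K hK).2]

end IsMarkedPoisson

lemma measurable_pastAlgebra_prod_markWeight {Ω : Type*} {e z : ℕ → Ω → ℝ} {R : Set (ℝ × ℝ)}
    {θ : ℝ} (hR : MeasurableSet R) (K : ℕ) :
    Measurable[pastAlgebra e z K] fun ω =>
      (∏ k ∈ Finset.range K, markWeight R θ (poissonJumpTime (e · ω) k, z k ω),
        ∑ i ∈ Finset.range K, e i ω) := by
  have he : ∀ k < K, Measurable[pastAlgebra e z K] (e k) := fun k hk =>
    measurable_iff_comap_le.2 (le_iSup₂_of_le (Sum.inl k) hk le_rfl)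
  have hz : ∀ k < K, Measurable[pastAlgebra e z K] (z k) := fun k hk =>
    measurable_iff_comap_le.2 (le_iSup₂_of_le (Sum.inr k) hk le_rfl)
  have hsum : ∀ j ≤ K, Measurable[pastAlgebra e z K] fun ω => ∑ i ∈ Finset.range j, e i ω :=
    fun j hj => Finset.measurable_fun_sum _ fun i hi => he i ((Finset.mem_range.1 hi).trans_le hj)
  refine Measurable.prodMk (Finset.measurable_fun_prod _ fun k hk => ?_) (hsum K le_rfl)
  exact (measurable_markWeight hR).comp
    ((hsum (k + 1) (Finset.mem_range.1 hk)).prodMk (hz k (Finset.mem_range.1 hk)))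

lemma pastAlgebra_le {Ω : Type*} [m : MeasurableSpace Ω] {e z : ℕ → Ω → ℝ}
    (he : ∀ k, Measurable (e k)) (hz : ∀ k, Measurable (z k)) (K : ℕ) : pastAlgebra e z K ≤ m := by
  refine iSup₂_le ?_
  rintro (i | i) -
  exacts [(he i).comap_le, (hz i).comap_le]

namespace IsMarkedPoisson

variable {Ω : Type*} [MeasurableSpace Ω] {P : Measure Ω} [IsProbabilityMeasure P]
  {e z : ℕ → Ω → ℝ} {R : Set (ℝ × ℝ)} {L θ : ℝ}

lemma map_prodMk (h : IsMarkedPoisson P e z) (K : ℕ) :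
    P.map (fun ω => (e K ω, z K ω)) = (expMeasure 1).prod (expMeasure 1) := by
  have hind : IndepFun (e K) (z K) P :=
    h.iIndep.indepFun (i := Sum.inl K) (j := Sum.inr K) Sum.inl_ne_inr
  rw [(indepFun_iff_map_prod_eq_prod_map_map (h.measurable_e K).aemeasurable
    (h.measurable_z K).aemeasurable).1 hind, h.map_e, h.map_z]

lemma lintegral_past_mul_markWeight_mul_tailFactor (h : IsMarkedPoisson P e z)
    (hR : MeasurableSet R) (hL : ∀ p ∈ R, p.1 ≤ L) {K : ℕ} {W : Ω → ℝ≥0∞} {S : Ω → ℝ}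
    (hWS : Measurable[pastAlgebra e z K] fun ω => (W ω, S ω)) :
    ∫⁻ ω, W ω * (markWeight R θ (S ω + e K ω, z K ω) * tailFactor R L θ (S ω + e K ω)) ∂P
      = ∫⁻ ω, W ω * tailFactor R L θ (S ω) ∂P := by
  have hU : Measurable fun ω => (W ω, S ω) :=
    hWS.mono (pastAlgebra_le h.measurable_e h.measurable_z K) le_rfl
  have hY : Measurable fun ω => (e K ω, z K ω) := (h.measurable_e K).prodMk (h.measurable_z K)
  have hlaw := (indepFun_iff_map_prod_eq_prod_map_map hU.aemeasurable hY.aemeasurable).1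
    (h.indepFun_of_measurable_pastAlgebra hWS)
  rw [h.map_prodMk K] at hlaw
  have hfactor : Measurable fun q : ℝ × ℝ × ℝ =>
      markWeight R θ (q.1 + q.2.1, q.2.2) * tailFactor R L θ (q.1 + q.2.1) :=
    measurable_markWeight_mul_tailFactor hR
  have hG : Measurable fun q : (ℝ≥0∞ × ℝ) × (ℝ × ℝ) => q.1.1 *
      (markWeight R θ (q.1.2 + q.2.1, q.2.2) * tailFactor R L θ (q.1.2 + q.2.1)) :=
    measurable_fst.fst.mul (hfactor.comp (measurable_fst.snd.prodMk measurable_snd))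
  have hG' : Measurable fun q : ℝ≥0∞ × ℝ => q.1 * tailFactor R L θ q.2 :=
    measurable_fst.mul ((measurable_tailFactor hR).comp measurable_snd)
  rw [← lintegral_map hG (hU.prodMk hY), hlaw, lintegral_prod _ hG.aemeasurable,
    ← lintegral_map hG' hU]
  refine lintegral_congr fun q => ?_
  exact (lintegral_const_mul q.1 (hfactor.comp (measurable_prodMk_left (x := q.2)))).trans
    (congrArg (q.1 * ·) (lintegral_markWeight_mul_tailFactor hR hL q.2))

lemma lintegral_momentMartingale (h : IsMarkedPoisson P e z) (hR : MeasurableSet R)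
    (hL : ∀ p ∈ R, p.1 ≤ L) (K : ℕ) :
    ∫⁻ ω, momentMartingale R L θ (e · ω) (z · ω) K ∂P = tailFactor R L θ 0 := by
  induction K with
  | zero => simp [momentMartingale]
  | succ K ih =>
    rw [← ih]
    simp only [momentMartingale, Finset.prod_range_succ, Finset.sum_range_succ, mul_assoc]
    simpa only [poissonJumpTime, Finset.sum_range_succ] using
      h.lintegral_past_mul_markWeight_mul_tailFactor hR hL
        (measurable_pastAlgebra_prod_markWeight hR K)

lemma lintegral_exp_numRetained_le (h : IsMarkedPoisson P e z) (hR : MeasurableSet R)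
    (hL : ∀ p ∈ R, p.1 ≤ L) (hL₀ : 0 ≤ L) (θ : ℝ) :
    ∫⁻ ω, ENNReal.ofReal (Real.exp (θ * (numRetained R (e · ω) (z · ω)).toReal)) ∂P
      ≤ tailFactor R L θ 0 :=
  calc
    _ = ∫⁻ ω, liminf (fun K => momentMartingale R L θ (e · ω) (z · ω) K) atTop ∂P :=
      lintegral_congr_ae
        ((h.ae_tendsto_momentMartingale hL hL₀).mono fun ω hω => hω.liminf_eq.symm)
    _ ≤ liminf (fun K => ∫⁻ ω, momentMartingale R L θ (e · ω) (z · ω) K ∂P) atTop :=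
      lintegral_liminf_le (h.measurable_momentMartingale hR)
    _ = tailFactor R L θ 0 := by simp only [h.lintegral_momentMartingale hR hL, liminf_const]

theorem lintegral_exp_numRetained (h : IsMarkedPoisson P e z) (hR : MeasurableSet R)
    (hL : ∀ p ∈ R, p.1 ≤ L) (hL₀ : 0 ≤ L) (θ : ℝ) :
    ∫⁻ ω, ENNReal.ofReal (Real.exp (θ * (numRetained R (e · ω) (z · ω)).toReal)) ∂P
      = tailFactor R L θ 0 := by
  -- Fatou's lemma makes the dominating function integrable.
  have hfatou := h.lintegral_exp_numRetained_le hR hL hL₀ θ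
  have hlim := tendsto_lintegral_of_dominated_convergence
    (fun ω => (1 + ENNReal.ofReal (Real.exp (θ * (numRetained R (e · ω) (z · ω)).toReal))) *
      ENNReal.ofReal (Real.exp (|Real.exp θ - 1| * ∫ r in (0 : ℝ)..L, retention R r)))
    (h.measurable_momentMartingale hR) (fun K => ?_) ?_
    (h.ae_tendsto_momentMartingale (θ := θ) hL hL₀)
  · simp only [h.lintegral_momentMartingale hR hL] at hlim
    exact tendsto_nhds_unique hlim tendsto_const_nhds
  · filter_upwards [h.ae_pos, h.ae_exists_gt hL₀] with ω hpos hgt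
    exact mul_le_mul' (prod_markWeight_le hL (fun k => (hpos k).1.le) hgt K)
      (tailFactor_le hR hL hL₀ (Finset.sum_nonneg fun i _ => (hpos i).1.le))
  · rw [lintegral_mul_const' _ _ ENNReal.ofReal_ne_top, lintegral_add_left measurable_const,
      lintegral_const, measure_univ]
    exact ENNReal.mul_ne_top
      (ENNReal.add_ne_top.2 ⟨by simp, (hfatou.trans_lt ENNReal.ofReal_lt_top).ne⟩)
      ENNReal.ofReal_ne_top

theorem map_numRetained (h : IsMarkedPoisson P e z) (hR : MeasurableSet R)
    (hL : ∀ p ∈ R, p.1 ≤ L) (hL₀ : 0 ≤ L) :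
    P.map (fun ω => (numRetained R (e · ω) (z · ω)).toReal) =
      (poissonMeasure (∫ r in (0 : ℝ)..L, retention R r).toNNReal).map (fun k : ℕ => (k : ℝ)) := by
  set X : Ω → ℝ := fun ω => (numRetained R (e · ω) (z · ω)).toReal
  have hX : Measurable X := (h.measurable_numRetained hR).ennreal_toReal
  have hmoment := h.lintegral_exp_numRetained hR hL hL₀
  have hint : ∀ θ, Integrable (fun ω => Real.exp (θ * X ω)) P := fun θ => by
    refine ⟨(hX.const_mul θ).exp.aestronglyMeasurable, ?_⟩
    rw [hasFiniteIntegral_iff_ofReal (.of_forall fun ω => Real.exp_nonneg _), hmoment θ]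
    exact ENNReal.ofReal_lt_top
  have hmgf : mgf X P = mgf (fun k : ℕ => (k : ℝ))
      (poissonMeasure (∫ r in (0 : ℝ)..L, retention R r).toNNReal) := by
    funext θ
    rw [mgf_poissonMeasure, Real.coe_toNNReal _
      (intervalIntegral.integral_nonneg hL₀ fun u _ => (retention_mem_Icc u).1), mgf,
      integral_eq_lintegral_of_nonneg_ae (.of_forall fun ω => Real.exp_nonneg _)
        (hint θ).aestronglyMeasurable, hmoment θ, tailFactor,
      ENNReal.toReal_ofReal (Real.exp_nonneg _), mul_comm]
  refine Measure.ext_of_complexMGF_eq hX.aemeasurable (by fun_prop) (funext fun w => ?_)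
  exact eqOn_complexMGF_of_mgf hmgf (by simp [integrableExpSet, hint])

end IsMarkedPoisson

/-! ### The number of jobs for a fixed path -/

/-- The time at which the cumulative arrival rate reaches the level `u`; it is `∞` if the level is
never reached. The arrival time of a job is the hitting time of a point of the standard Poisson
process. -/
noncomputable def hitTime {E : Type*} (lam : E → ℝ≥0) (f : ℝ≥0 → E) (u : ℝ) : ℝ≥0∞ :=
  ⨅ (s : ℝ≥0) (_ : u ≤ cumRate lam f s), (s : ℝ≥0∞)

/-- The region of those pairs of a point of the standard Poisson process and a standard exponential
requirement whose job is in the system at time `t`. -/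
def systemSet {E : Type*} (lam kap mu : E → ℝ≥0) (f : ℝ≥0 → E) (t : ℝ≥0) : Set (ℝ × ℝ) :=
  {p | hitTime lam f p.1 ≤ t ∧ ¬ serviceRequirement kap (f (hitTime lam f p.1).toNNReal) p.2
    ≤ workDone mu f (hitTime lam f p.1).toNNReal t}

section FixedPath

variable {E : Type*} (lam kap mu : E → ℝ≥0) (t : ℝ≥0)

lemma numJobs_eq_numRetained (f : ℝ≥0 → E) (e z : ℕ → ℝ) :
    numJobs lam kap mu f e z t = numRetained (systemSet lam kap mu f t) e z := by
  classical
  refine tsum_congr fun k => ?_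
  rw [Set.indicator_apply]
  congr!

lemma monotone_hitTime (f : ℝ≥0 → E) : Monotone (hitTime lam f) := fun _ _ huv =>
  iInf_mono fun _ => iInf_mono' fun h => ⟨huv.trans h, le_rfl⟩

lemma real_not_serviceRequirement_le (x : E) {w : ℝ} (hw : 0 ≤ w) :
    (expMeasure 1).real {ζ | ¬ serviceRequirement kap x ζ ≤ ENNReal.ofReal w}
      = Real.exp (-((kap x : ℝ) * w)) := by
  by_cases hx : kap x = 0
  · simp [serviceRequirement, hx]
  · have hk : 0 < (kap x : ℝ) := NNReal.coe_pos.2 (pos_iff_ne_zero.2 hx)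
    have hset : {ζ | ¬ serviceRequirement kap x ζ ≤ ENNReal.ofReal w}
        = (Set.Iic ((kap x : ℝ) * w))ᶜ := by
      ext ζ
      simp only [serviceRequirement, hx, if_false, Set.mem_ofPred_eq, not_le, Set.mem_compl_iff,
        Set.mem_Iic]
      rw [ENNReal.ofReal_lt_ofReal_iff_of_nonneg hw, lt_div_iff₀ hk, mul_comm]
    rw [hset, probReal_compl_eq_one_sub measurableSet_Iic, ← cdf_eq_real,
      cdf_expMeasure_eq one_pos, if_pos (by positivity)]
    simp

lemma phi_const_mul (c : ℝ≥0) (f : ℝ≥0 → E) :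
    phi (fun x => c * lam x) kap mu t f = c * phi lam kap mu t f := by
  rw [phi, phi, ← intervalIntegral.integral_const_mul]
  refine intervalIntegral.integral_congr fun s _ => ?_
  push_cast
  ring

variable [Finite E] [MeasurableSpace E] [MeasurableSingletonClass E] {f : ℝ≥0 → E}

lemma continuous_cumRate (hf : Measurable f) : Continuous (cumRate lam f) :=
  (continuous_integral_comp_path lam hf 0).comp NNReal.continuous_coe

lemma monotone_cumRate (hf : Measurable f) : Monotone (cumRate lam f) := fun a _ hab =>
  intervalIntegral.integral_mono_interval le_rfl a.coe_nonneg (NNReal.coe_le_coe.2 hab)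
    (.of_forall fun _ => NNReal.coe_nonneg _) (intervalIntegrable_comp_path lam hf _ _)

lemma hitTime_le_iff (hf : Measurable f) (u : ℝ) (s : ℝ≥0) :
    hitTime lam f u ≤ s ↔ u ≤ cumRate lam f s := by
  refine ⟨fun h => ?_, fun h => iInf₂_le s h⟩
  by_contra! hlt
  obtain ⟨r, hr, hsr⟩ : ∃ r, cumRate lam f r < u ∧ s < r :=
    ((((continuous_cumRate lam hf).tendsto s).eventually (gt_mem_nhds hlt)).filter_mono
      nhdsWithin_le_nhds |>.and (self_mem_nhdsWithin (s := Set.Ioi s))).exists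
  have hhit : (r : ℝ≥0∞) ≤ hitTime lam f u := le_iInf₂ fun q hq =>
    ENNReal.coe_le_coe.2 (le_of_lt ((monotone_cumRate lam hf).reflect_lt (hr.trans_le hq)))
  exact ((ENNReal.coe_lt_coe.2 hsr).trans_le hhit).not_ge h

lemma preimage_hitTime_Iic_inter_Ioc (hf : Measurable f) (a : ℝ≥0) :
    (fun u => ((hitTime lam f u).toNNReal : ℝ)) ⁻¹' Set.Iic (a : ℝ) ∩ Set.Ioc 0 (cumRate lam f t)
      = Set.Ioc 0 (cumRate lam f (min a t)) := by
  ext u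
  have hiff (hu : u ≤ cumRate lam f t) :
      (hitTime lam f u).toNNReal ≤ a ↔ u ≤ cumRate lam f a := by
    have hfin : hitTime lam f u ≠ ⊤ :=
      (((hitTime_le_iff lam hf u t).2 hu).trans_lt ENNReal.coe_lt_top).ne
    rw [← hitTime_le_iff lam hf u a, ← ENNReal.coe_le_coe, ENNReal.coe_toNNReal hfin]
  simp only [Set.mem_inter_iff, Set.mem_preimage, Set.mem_Iic, Set.mem_Ioc, NNReal.coe_le_coe,
    (monotone_cumRate lam hf).map_min, le_min_iff]
  tauto

lemma setLIntegral_comp_path_Ioc (hf : Measurable f) (s : ℝ≥0) :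
    ∫⁻ r in Set.Ioc (0 : ℝ) s, (lam (f r.toNNReal) : ℝ≥0∞) = ENNReal.ofReal (cumRate lam f s) := by
  rw [cumRate, intervalIntegral.integral_of_le s.coe_nonneg, ofReal_integral_eq_lintegral_ofReal
    (intervalIntegrable_comp_path lam hf 0 s).1 (.of_forall fun _ => NNReal.coe_nonneg _)]
  simp only [ENNReal.ofReal_coe_nnreal]

lemma map_hitTime (hf : Measurable f) :
    Measure.map (fun u => ((hitTime lam f u).toNNReal : ℝ))
      (volume.restrict (Set.Ioc 0 (cumRate lam f t)))
      = (volume.restrict (Set.Ioc (0 : ℝ) t)).withDensity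
        (fun s => (lam (f s.toNNReal) : ℝ≥0∞)) := by
  have hm : Measurable (fun u => ((hitTime lam f u).toNNReal : ℝ)) :=
    (monotone_hitTime lam f).measurable.ennreal_toNNReal.coe_nnreal_real
  refine Measure.ext_of_Iic _ _ fun a => ?_
  rw [Measure.map_apply hm measurableSet_Iic, withDensity_apply _ measurableSet_Iic,
    Measure.restrict_restrict measurableSet_Iic, Measure.restrict_apply (hm measurableSet_Iic)]
  rcases lt_or_ge a 0 with ha | ha
  · have hpre : (fun u => ((hitTime lam f u).toNNReal : ℝ)) ⁻¹' Set.Iic a = ∅ :=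
      Set.eq_empty_of_forall_notMem fun u hu => (ha.trans_le (NNReal.coe_nonneg _)).not_ge hu
    have hinter : Set.Iic a ∩ Set.Ioc (0 : ℝ) t = ∅ :=
      Set.eq_empty_of_forall_notMem fun s hs => (ha.trans hs.2.1).not_ge hs.1
    simp only [hpre, hinter, Set.empty_inter, measure_empty, Measure.restrict_empty,
      lintegral_zero_measure]
  · lift a to ℝ≥0 using ha
    have hinter : Set.Iic (a : ℝ) ∩ Set.Ioc (0 : ℝ) t = Set.Ioc (0 : ℝ) (min a t : ℝ≥0) := by
      rw [Set.inter_comm, Set.Ioc_inter_Iic, NNReal.coe_min, min_comm]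
    rw [preimage_hitTime_Iic_inter_Ioc lam t hf, hinter, setLIntegral_comp_path_Ioc lam hf,
      Real.volume_Ioc, sub_zero]

lemma retention_systemSet (hf : Measurable f) {u : ℝ} (hu : u ≤ cumRate lam f t) :
    retention (systemSet lam kap mu f t) u
      = retainedRate (fun _ => 1) kap mu t f (hitTime lam f u).toNNReal := by
  have hle := (hitTime_le_iff lam hf u t).2 hu
  have hle' : (hitTime lam f u).toNNReal ≤ t := by
    simpa using ENNReal.toNNReal_mono ENNReal.coe_ne_top hle
  rw [retainedRate, NNReal.coe_one, one_mul, Real.toNNReal_coe,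
    ← real_not_serviceRequirement_le kap _
      (intervalIntegral_comp_path_nonneg mu f (NNReal.coe_le_coe.2 hle'))]
  simp only [retention, systemSet, Set.mem_ofPred_eq, hle, true_and]
  rfl

lemma integral_retention_systemSet (hf : Measurable f) :
    ∫ u in (0 : ℝ)..(cumRate lam f t), retention (systemSet lam kap mu f t) u
      = phi lam kap mu t f := by
  set p : ℝ → ℝ := retainedRate (fun _ => 1) kap mu t f with hp
  have hm : Measurable (fun u => ((hitTime lam f u).toNNReal : ℝ)) :=
    (monotone_hitTime lam f).measurable.ennreal_toNNReal.coe_nnreal_real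
  calc ∫ u in (0 : ℝ)..(cumRate lam f t), retention (systemSet lam kap mu f t) u
      = ∫ u in Set.Ioc 0 (cumRate lam f t), p (hitTime lam f u).toNNReal := by
        have hnonneg : 0 ≤ cumRate lam f t := intervalIntegral_comp_path_nonneg lam f t.coe_nonneg
        rw [intervalIntegral.integral_of_le hnonneg]
        exact setIntegral_congr_fun measurableSet_Ioc fun u hu =>
          retention_systemSet lam kap mu t hf hu.2
    _ = ∫ s, p s ∂((volume.restrict (Set.Ioc (0 : ℝ) t)).withDensity
          (fun s => (lam (f s.toNNReal) : ℝ≥0∞))) := by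
        rw [← map_hitTime lam t hf, integral_map hm.aemeasurable
          (measurable_retainedRate (fun _ => 1) kap mu t hf).aestronglyMeasurable]
    _ = ∫ s in Set.Ioc (0 : ℝ) t, lam (f s.toNNReal) • p s :=
        integral_withDensity_eq_integral_smul
          ((measurable_of_finite lam).comp (hf.comp measurable_real_toNNReal)) p
    _ = phi lam kap mu t f := by
        simp only [phi, intervalIntegral.integral_of_le t.coe_nonneg, hp, retainedRate,
          NNReal.coe_one, one_mul, NNReal.smul_def, smul_eq_mul]

end FixedPath

section PathFamily

variable {Ω E : Type*} [MeasurableSpace Ω] [Finite E] [MeasurableSpace E]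
  [MeasurableSingletonClass E] {J : ℝ≥0 → Ω → E} (lam kap mu : E → ℝ≥0) (t : ℝ≥0)

lemma measurable_hitTime (hJ : Measurable (Function.uncurry J)) :
    Measurable (fun p : Ω × ℝ => hitTime lam (fun s => J s p.1) p.2) := by
  refine measurable_of_Iic fun a => ?_
  induction a with
  | top => simp
  | coe s =>
    have hpre : (fun p : Ω × ℝ => hitTime lam (fun s => J s p.1) p.2) ⁻¹' Set.Iic (s : ℝ≥0∞)
        = {p | p.2 ≤ cumRate lam (fun s => J s p.1) s} :=
      Set.ext fun p => hitTime_le_iff lam (hJ.comp measurable_prodMk_right) p.2 s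
    rw [hpre]
    exact measurableSet_le measurable_snd ((measurable_integral_comp_process hJ lam
      measurable_const measurable_const).comp measurable_fst)

lemma measurable_serviceRequirement :
    Measurable (fun p : E × ℝ => serviceRequirement kap p.1 p.2) := by
  refine measurable_from_prod_countable_right fun x => ?_
  by_cases hx : kap x = 0
  · simp only [serviceRequirement, hx, if_true, measurable_const]
  · simp only [serviceRequirement, hx, if_false]
    exact (measurable_id.div_const _).ennreal_ofReal

lemma measurableSet_mem_systemSet (hJ : Measurable (Function.uncurry J)) :
    MeasurableSet {p : Ω × (ℝ × ℝ) | p.2 ∈ systemSet lam kap mu (fun s => J s p.1) t} := by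
  have hhit : Measurable (fun p : Ω × (ℝ × ℝ) => hitTime lam (fun s => J s p.1) p.2.1) :=
    (measurable_hitTime lam hJ).comp (measurable_fst.prodMk measurable_snd.fst)
  have hstate : Measurable (fun p : Ω × (ℝ × ℝ) =>
      J (hitTime lam (fun s => J s p.1) p.2.1).toNNReal p.1) :=
    hJ.comp (hhit.ennreal_toNNReal.prodMk measurable_fst)
  have hrequirement : Measurable (fun p : Ω × (ℝ × ℝ) => serviceRequirement kap
      (J (hitTime lam (fun s => J s p.1) p.2.1).toNNReal p.1) p.2.2) :=
    (measurable_serviceRequirement kap).comp (hstate.prodMk measurable_snd.snd)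
  have hwork : Measurable (fun p : Ω × (ℝ × ℝ) => workDone mu (fun s => J s p.1)
      (hitTime lam (fun s => J s p.1) p.2.1).toNNReal t) :=
    (measurable_integral_comp_process (measurable_uncurry_comp_fst hJ) mu
      hhit.ennreal_toNNReal.coe_nnreal_real measurable_const).ennreal_ofReal
  exact (measurableSet_le hhit measurable_const).inter (measurableSet_le hrequirement hwork).compl

lemma measurableSet_systemSet {f : ℝ≥0 → E} (hf : Measurable f) :
    MeasurableSet (systemSet lam kap mu f t) :=
  measurable_prodMk_left (x := ()) (measurableSet_mem_systemSet lam kap mu t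
    (J := fun s (_ : Unit) => f s) (hf.comp measurable_fst))

lemma measurable_numJobs (hJ : Measurable (Function.uncurry J)) :
    Measurable (fun p : Ω × (ℕ ⊕ ℕ → ℝ) => numJobs lam kap mu (fun s => J s p.1)
      (fun k => p.2 (Sum.inl k)) (fun k => p.2 (Sum.inr k)) t) := by
  classical
  simp only [numJobs_eq_numRetained, numRetained, Set.indicator_apply]
  refine Measurable.tsum fun k => Measurable.ite ?_ measurable_const measurable_const
  have hpoint : Measurable fun p : Ω × (ℕ ⊕ ℕ → ℝ) =>
      poissonJumpTime (fun k => p.2 (Sum.inl k)) k :=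
    Finset.measurable_fun_sum _ fun i _ => (measurable_pi_apply (Sum.inl i)).comp measurable_snd
  have hrequirement : Measurable fun p : Ω × (ℕ ⊕ ℕ → ℝ) => p.2 (Sum.inr k) :=
    (measurable_pi_apply _).comp measurable_snd
  exact (measurable_fst.prodMk (hpoint.prodMk hrequirement))
    (measurableSet_mem_systemSet lam kap mu t hJ)

end PathFamily

namespace IsMarkedPoisson

variable {E Ω : Type*} [Finite E] [MeasurableSpace E] [MeasurableSingletonClass E]
  [MeasurableSpace Ω] {P : Measure Ω} [IsProbabilityMeasure P] {e z : ℕ → Ω → ℝ} {f : ℝ≥0 → E}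

theorem map_numJobs (h : IsMarkedPoisson P e z) (hf : Measurable f) (lam kap mu : E → ℝ≥0)
    (t : ℝ≥0) :
    P.map (fun ω => (numJobs lam kap mu f (e · ω) (z · ω) t).toReal)
      = (poissonMeasure (phi lam kap mu t f).toNNReal).map (fun k : ℕ => (k : ℝ)) := by
  simp only [numJobs_eq_numRetained]
  rw [h.map_numRetained (measurableSet_systemSet lam kap mu t hf)
    (fun p hp => (hitTime_le_iff lam hf p.1 t).1 hp.1)
    (intervalIntegral_comp_path_nonneg lam f t.coe_nonneg), integral_retention_systemSet _ _ _ _ hf]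

lemma map_numJobs_div (h : IsMarkedPoisson P e z) (hf : Measurable f) (lam kap mu : E → ℝ≥0)
    (t : ℝ≥0) (n : ℕ) :
    P.map (fun ω => (numJobs (fun x => n * lam x) kap mu f (e · ω) (z · ω) t).toReal / n)
      = scaledPoisson n (phi lam kap mu t f).toNNReal := by
  have hnum : Measurable fun ω =>
      (numJobs (fun x => n * lam x) kap mu f (e · ω) (z · ω) t).toReal := by
    simp only [numJobs_eq_numRetained]
    exact (h.measurable_numRetained (measurableSet_systemSet _ kap mu t hf)).ennreal_toReal
  have hdiv : Measurable fun x : ℝ => x / n := measurable_id.div_const _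
  have hmap := congrArg (Measure.map (· / (n : ℝ))) (h.map_numJobs hf (fun x => n * lam x) kap mu t)
  rwa [Measure.map_map hdiv hnum, Measure.map_map hdiv .of_discrete, phi_const_mul,
    Real.toNNReal_mul (NNReal.coe_nonneg _), Real.toNNReal_coe] at hmap

end IsMarkedPoisson

/-! ### The law of the number of jobs -/

lemma map_apply_of_indepFun {Ω α β γ : Type*} [MeasurableSpace Ω] [MeasurableSpace α]
    [MeasurableSpace β] [MeasurableSpace γ] {P : Measure Ω} [IsFiniteMeasure P] {X : Ω → α}
    {Y : Ω → β} (hXY : IndepFun X Y P) (hX : Measurable X) (hY : Measurable Y) {F : α × β → γ}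
    (hF : Measurable F) {B : Set γ} (hB : MeasurableSet B) :
    P.map (fun ω => F (X ω, Y ω)) B = ∫⁻ ω, P.map (fun ω' => F (X ω, Y ω')) B ∂P := by
  have hlaw := (indepFun_iff_map_prod_eq_prod_map_map hX.aemeasurable hY.aemeasurable).1 hXY
  calc P.map (fun ω => F (X ω, Y ω)) B
      = P.map (fun ω => (X ω, Y ω)) (F ⁻¹' B) := by
        rw [← Measure.map_apply hF hB, Measure.map_map hF (hX.prodMk hY)]
        rfl
    _ = ∫⁻ ω, P.map Y (Prod.mk (X ω) ⁻¹' (F ⁻¹' B)) ∂P := by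
        rw [hlaw, Measure.prod_apply (hF hB),
          lintegral_map (measurable_measure_prodMk_left (hF hB)) hX]
    _ = ∫⁻ ω, P.map (fun ω' => F (X ω, Y ω')) B ∂P := by
        refine lintegral_congr fun ω => ?_
        rw [← Set.preimage_comp, ← Measure.map_apply (hF.comp measurable_prodMk_left) hB,
          Measure.map_map (hF.comp measurable_prodMk_left) hY]
        rfl

lemma isBackgroundProcess_coordinate {E : Type*} [TopologicalSpace E] [MeasurableSpace E] :
    IsBackgroundProcess fun (s : ℝ≥0) (f : {f : ℝ≥0 → E // IsCadlag f}) => f.1 s :=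
  ⟨fun s => (measurable_pi_apply s).comp measurable_subtype_coe, fun f => f.2⟩

namespace IsQueueInput

section Basic

variable {Ω E : Type*} [MeasurableSpace Ω] [TopologicalSpace E] [MeasurableSpace E]
  {P : Measure Ω} {J : ℝ≥0 → Ω → E} {e z : ℕ → Ω → ℝ}

lemma isMarkedPoisson (h : IsQueueInput P J e z) : IsMarkedPoisson P e z :=
  ⟨h.measurable_e, h.measurable_z, h.map_e, h.map_z, h.iIndep⟩

lemma measurable_input (h : IsQueueInput P J e z) :
    Measurable fun ω (i : ℕ ⊕ ℕ) => Sum.elim e z i ω := by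
  refine measurable_pi_lambda _ ?_
  rintro (i | i)
  exacts [h.measurable_e i, h.measurable_z i]

/-- The path of the background process, as an element of the subtype of càdlàg functions: on that
subtype the coordinate process is jointly measurable, which it is not on all functions. -/
def path (h : IsQueueInput P J e z) (ω : Ω) : {f : ℝ≥0 → E // IsCadlag f} :=
  ⟨fun s => J s ω, h.background.cadlag ω⟩

lemma measurable_path (h : IsQueueInput P J e z) : Measurable h.path :=
  Measurable.subtype_mk (measurable_pi_lambda _ h.background.measurable)

lemma indepFun_path (h : IsQueueInput P J e z) :
    IndepFun h.path (fun ω (i : ℕ ⊕ ℕ) => Sum.elim e z i ω) P := by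
  have hcomap : MeasurableSpace.comap h.path inferInstance
      = MeasurableSpace.comap (fun ω (s : ℝ≥0) => J s ω) inferInstance :=
    MeasurableSpace.comap_comp
  rw [IndepFun_iff_Indep, hcomap, ← IndepFun_iff_Indep]
  exact h.indep

end Basic

variable {Ω E : Type*} [MeasurableSpace Ω] {P : Measure Ω} [Finite E] [TopologicalSpace E]
  [TopologicalSpace.PseudoMetrizableSpace E] [MeasurableSpace E] [BorelSpace E]
  [MeasurableSingletonClass E] {J : ℝ≥0 → Ω → E} {e z : ℕ → Ω → ℝ}

lemma exists_ae_paramLaw_mem_Icc (h : IsQueueInput P J e z) (lam kap mu : E → ℝ≥0) (t : ℝ≥0) :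
    ∃ C : ℝ, ∀ᵐ γ ∂(paramLaw P J lam kap mu t), γ ∈ Set.Icc 0 C := by
  obtain ⟨M, hM⟩ := Finite.exists_le lam
  exact ⟨M * t, (ae_map_iff
    (measurable_phi h.background.measurable_uncurry lam kap mu t).aemeasurable
      measurableSet_Icc).2 (.of_forall fun ω =>
        ⟨phi_nonneg lam kap mu t _, phi_le lam kap mu t hM (h.background.cadlag ω).measurable⟩)⟩

variable [IsProbabilityMeasure P]

theorem scaledLaw_eq_poissonMixture (h : IsQueueInput P J e z) (lam kap mu : E → ℝ≥0) (t : ℝ≥0)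
    (n : ℕ) : scaledLaw P J e z lam kap mu t n = poissonMixture (paramLaw P J lam kap mu t) n := by
  refine Measure.ext fun B hB => ?_
  have hF := (measurable_numJobs (fun x => n * lam x) kap mu t
    isBackgroundProcess_coordinate.measurable_uncurry).ennreal_toReal.div_const (n : ℝ)
  calc scaledLaw P J e z lam kap mu t n B
      = ∫⁻ ω, P.map (fun ω' => (numJobs (fun x => n * lam x) kap mu (fun s => J s ω) (e · ω')
          (z · ω') t).toReal / n) B ∂P :=
        map_apply_of_indepFun h.indepFun_path h.measurable_path h.measurable_input hF hB
    _ = ∫⁻ ω, scaledPoisson n (phi lam kap mu t (fun s => J s ω)).toNNReal B ∂P :=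
        lintegral_congr fun ω => by
          rw [h.isMarkedPoisson.map_numJobs_div (h.background.cadlag ω).measurable]
    _ = poissonMixture (paramLaw P J lam kap mu t) n B := by
        rw [poissonMixture_apply hB]
        exact (lintegral_map ((Measure.measurable_coe hB).comp
          ((measurable_scaledPoisson n).comp measurable_real_toNNReal))
          (measurable_phi h.background.measurable_uncurry lam kap mu t)).symm

lemma isProbabilityMeasure_paramLaw (h : IsQueueInput P J e z) (lam kap mu : E → ℝ≥0) (t : ℝ≥0) :
    IsProbabilityMeasure (paramLaw P J lam kap mu t) :=
  Measure.isProbabilityMeasure_map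
    (measurable_phi h.background.measurable_uncurry lam kap mu t).aemeasurable

theorem satisfiesLDP_scaledLaw (h : IsQueueInput P J e z) (lam kap mu : E → ℝ≥0) (t : ℝ≥0)
    {ψ : ℝ → ℝ≥0∞} (hψ : SatisfiesLDP (fun _ => paramLaw P J lam kap mu t) ψ) :
    SatisfiesLDP (scaledLaw P J e z lam kap mu t)
      (rateI (fun _ => paramLaw P J lam kap mu t) ψ) := by
  have hprob := h.isProbabilityMeasure_paramLaw lam kap mu t
  obtain ⟨C, hC⟩ := h.exists_ae_paramLaw_mem_Icc lam kap mu t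
  rw [rateI_const hψ, funext (h.scaledLaw_eq_poissonMixture lam kap mu t)]
  exact satisfiesLDP_poissonMixture hC

lemma isGoodRateFunction_rateI (h : IsQueueInput P J e z) (lam kap mu : E → ℝ≥0) (t : ℝ≥0)
    {ψ : ℝ → ℝ≥0∞} (hψ : SatisfiesLDP (fun _ => paramLaw P J lam kap mu t) ψ) :
    IsGoodRateFunction (rateI (fun _ => paramLaw P J lam kap mu t) ψ) := by
  have hprob := h.isProbabilityMeasure_paramLaw lam kap mu t
  obtain ⟨C, hC⟩ := h.exists_ae_paramLaw_mem_Icc lam kap mu t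
  rw [rateI_const hψ]
  exact isGoodRateFunction_iInf_ell (isCompact_attainable_const hC)

end IsQueueInput

end ModulatedQueue

theorem mainTheorem6 {E : Type*} [Fintype E] [DecidableEq E] [MetricSpace E] [MeasurableSpace E]
    [BorelSpace E] (lam kap mu : E → ℝ≥0) (t : ℝ≥0)
    {Ω₁ : Type*} [MeasurableSpace Ω₁] (P₁ : Measure Ω₁) [IsProbabilityMeasure P₁]
    (J₁ : ℝ≥0 → Ω₁ → E) (e₁ z₁ : ℕ → Ω₁ → ℝ)
    (h₁ : ModulatedQueue.IsQueueInput P₁ J₁ e₁ z₁)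
    {Ω₂ : Type*} [MeasurableSpace Ω₂] (P₂ : Measure Ω₂) [IsProbabilityMeasure P₂]
    (J₂ : ℝ≥0 → Ω₂ → E) (e₂ z₂ : ℕ → Ω₂ → ℝ)
    (h₂ : ModulatedQueue.IsQueueInput P₂ J₂ e₂ z₂)
    (hJ₂ : ModulatedQueue.IsIrreducibleMarkovChain P₂ J₂) :
    let ν₁ : ℕ → Measure ℝ := fun _ => ModulatedQueue.paramLaw P₁ J₁ lam kap mu t
    let ν₂ : ℕ → Measure ℝ := fun _ => ModulatedQueue.paramLaw P₂ J₂ lam kap mu t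
    (∃ ψ₁, ModulatedQueue.SatisfiesLDP ν₁ ψ₁) ∧ (∃ ψ₂, ModulatedQueue.SatisfiesLDP ν₂ ψ₂) ∧
    ∀ ψ₁ ψ₂ : ℝ → ℝ≥0∞,
      ModulatedQueue.SatisfiesLDP ν₁ ψ₁ → ModulatedQueue.SatisfiesLDP ν₂ ψ₂ →
      ModulatedQueue.SatisfiesLDP
          (ModulatedQueue.scaledLaw P₁ J₁ e₁ z₁ lam kap mu t) (ModulatedQueue.rateI ν₁ ψ₁) ∧
      ModulatedQueue.SatisfiesLDP
          (ModulatedQueue.scaledLaw P₂ J₂ e₂ z₂ lam kap mu t) (ModulatedQueue.rateI ν₂ ψ₂) ∧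
      (∀ a : ℝ, ModulatedQueue.rateI ν₂ ψ₂ a ≤ ModulatedQueue.rateI ν₁ ψ₁ a) ∧
      ModulatedQueue.IsGoodRateFunction (ModulatedQueue.rateI ν₁ ψ₁) ∧
      ModulatedQueue.IsGoodRateFunction (ModulatedQueue.rateI ν₂ ψ₂) := by
  intro ν₁ ν₂
  refine ⟨?_, ?_, fun ψ₁ ψ₂ hψ₁ hψ₂ =>
    ⟨h₁.satisfiesLDP_scaledLaw lam kap mu t hψ₁, h₂.satisfiesLDP_scaledLaw lam kap mu t hψ₂,
      fun a => ?_, h₁.isGoodRateFunction_rateI lam kap mu t hψ₁,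
      h₂.isGoodRateFunction_rateI lam kap mu t hψ₂⟩⟩
  · have := h₁.isProbabilityMeasure_paramLaw lam kap mu t
    exact ⟨_, ModulatedQueue.satisfiesLDP_const _⟩
  · have := h₂.isProbabilityMeasure_paramLaw lam kap mu t
    exact ⟨_, ModulatedQueue.satisfiesLDP_const _⟩
  · have := h₁.isProbabilityMeasure_paramLaw lam kap mu t
    have := h₂.isProbabilityMeasure_paramLaw lam kap mu t
    rw [ModulatedQueue.rateI_const hψ₁, ModulatedQueue.rateI_const hψ₂]
    exact biInf_mono (ModulatedQueue.attainable_subset_of_isIrreducibleMarkovChain hJ₂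
      h₂.background h₁.background lam kap mu t)
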